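/- For a cardinal $\theta$ let $H(\theta)$ be the set of all sets whose transitive closure has cardinality less than $\theta$, and write $M\preceq H(\theta)$ if $M$ is an elementary substructure of $\langle H(\theta),\in\rangle$. A Banach space $X$ (over $\mathbb R$) is regarded as a set, namely as the tuple of its underlying set, addition, scalar multiplication and norm; real numbers are Dedekind cuts and functionals are identified with their graphs. For $M\preceq H(\theta)$ let $X_M=\operatorname{cl}(X\cap M)$ be the norm closure of $X\cap M$, and for $B\subseteq X^*$ let ${}^\perp B=\{x\in X: b(x)=0\text{ for all }b\in B\}$. Let $X\neq\{0\}$ be a weakly compactly generated Banach space, i.e. $X$ contains a linearly dense weakly compact set. Then: (1) For every big enough regular cardinal $\theta$ (i.e. there is a cardinal $\theta_0$ such that for every regular $\theta>\theta_0$) and every $M\preceq H(\theta)$ with $X\in M$, there is a bounded linear projection $P_M:X\to X$ with $\|P_M\|=1$, $\operatorname{im}P_M=X_M$ and $\ker P_M={}^\perp(X^*\cap M)$. (2) In particular, $X^*$ generates projections in $X$. Here a set $D\subseteq X^*$ generates projections in $X$ if $D$ is norming (that is, there is $r$ with $\|x\|\le r\,\sup\{|\varphi(x)|/\|\varphi\|:\varphi\in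 D\setminus\{0\}\}$ for all $x\in X$) and, for every big enough regular cardinal $\theta$ and every countable $M\preceq H(\theta)$ with $D\in M$, one has $X=X_M\oplus{}^\perp(D\cap M)$. (3) $X$ has a projectional resolution of the identity: with $\lambda=\operatorname{dens}X$ regarded as an initial ordinal, which is a limit ordinal, there are bounded linear projections $(P_\xi)_{\xi<\lambda}$ on $X$ such that $P_\xi=P_\eta P_\xi=P_\xi P_\eta$ for $\xi<\eta<\lambda$; $P_\delta X=\operatorname{cl}\bigl(\bigcup_{\xi<\delta}P_\xi X\bigr)$ for every limit ordinal $\delta<\lambda$; $X=\operatorname{cl}\bigl(\bigcup_{\xi<\lambda}P_\xi X\bigr)$; and $\|P_\xi\|=1$ and $\operatorname{dens}(P_\xi X)\le|\xi|+\aleph_0$ for each $\xi<\lambda$. -/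

import Mathlib

open Cardinal

universe u

/-! ### Elementary substructures of `H(θ)` -/

namespace WCGProj

/-- The relation symbols of the language of set theory: a single binary symbol. -/
inductive SetRel : ℕ → Type
  | mem : SetRel 2

/-- The first-order language `{∈}` of set theory (equality is a logical symbol). -/
def setLang : FirstOrder.Language := ⟨fun _ => Empty, SetRel⟩

/-- `H(θ)`: the sets whose transitive closure has fewer than `θ` elements.  The transitive closure
of `x` consists of all `y` with `y ∈ x₀ ∈ ⋯ ∈ x`. -/
def hSet (θ : Cardinal.{u}) : Set ZFSet.{u} :=
  {x | #{y : ZFSet.{u} // Relation.TransGen (fun a b => a ∈ b) y x} < Cardinal.lift.{u + 1} θ}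

/-- The structure `⟨H(θ), ∈⟩`. -/
instance hStructure (θ : Cardinal.{u}) : setLang.Structure (hSet θ) where
  funMap := fun f => f.elim
  RelMap := fun r => match r with
    | SetRel.mem => fun v => (v 0 : ZFSet.{u}) ∈ (v 1 : ZFSet.{u})

/-- The type of all `M ≼ ⟨H(θ), ∈⟩`. -/
abbrev ElemSub (θ : Cardinal.{u}) : Type (u + 1) := setLang.ElementarySubstructure (hSet θ)

/-- The sets that are elements of `M ≼ H(θ)`. -/
def ElemSub.sets {θ : Cardinal.{u}} (M : ElemSub θ) : Set ZFSet.{u} :=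
  Subtype.val '' (M : Set (hSet θ))

/-! ### Natural and real numbers as sets -/

/-- The von Neumann numeral `n = {0, …, n - 1}`. -/
noncomputable def natCode : ℕ → ZFSet.{u}
  | 0 => ∅
  | n + 1 => insert (natCode n) (natCode n)

/-- The real number `r` as a Dedekind cut: the set of all formal fractions `(a - b) / (c + 1)`,
with natural numbers `a, b, c`, whose value is less than `r`. -/
noncomputable def realCode (r : ℝ) : ZFSet.{u} :=
  ZFSet.range fun t : {t : ℕ × ℕ × ℕ // ((t.1 : ℝ) - (t.2.1 : ℝ)) / ((t.2.2 : ℝ) + 1) < r} =>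
    ZFSet.pair (natCode t.1.1) (ZFSet.pair (natCode t.1.2.1) (natCode t.1.2.2))

/-! ### A Banach space and its functionals as sets

The points of `X` are sets, by means of an injection `ι : X ↪ ZFSet`; then `X` itself, the
functionals on `X`, and families of functionals are sets as well. -/

section Codes

variable {X : Type u} [NormedAddCommGroup X] [NormedSpace ℝ X] (ι : X ↪ ZFSet.{u})

/-- The underlying set of `X`. -/
noncomputable def carrierCode : ZFSet.{u} := ZFSet.range fun x : X => ι x

/-- The graph of the addition `X × X → X`. -/
noncomputable def addCode : ZFSet.{u} :=
  ZFSet.range fun p : X × X => ZFSet.pair (ZFSet.pair (ι p.1) (ι p.2)) (ι (p.1 + p.2))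

/-- The graph of the scalar multiplication `ℝ × X → X`. -/
noncomputable def smulCode : ZFSet.{u} :=
  ZFSet.range fun p : ℝ × X => ZFSet.pair (ZFSet.pair (realCode p.1) (ι p.2)) (ι (p.1 • p.2))

/-- The graph of the norm `X → ℝ`. -/
noncomputable def normCode : ZFSet.{u} :=
  ZFSet.range fun x : X => ZFSet.pair (ι x) (realCode ‖x‖)

/-- The normed space `X = ⟨X, +, ·, ‖·‖⟩` as a set. -/
noncomputable def spaceCode : ZFSet.{u} :=
  ZFSet.pair (carrierCode ι) (ZFSet.pair (addCode ι) (ZFSet.pair (smulCode ι) (normCode ι)))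

/-- A functional `f ∈ X*` as a set: the graph of `f : X → ℝ`. -/
noncomputable def funCode (f : StrongDual ℝ X) : ZFSet.{u} :=
  ZFSet.range fun x : X => ZFSet.pair (ι x) (realCode (f x))

/-- A set `D ⊆ X*` of functionals as a set. -/
noncomputable def famCode (D : Set (StrongDual ℝ X)) : ZFSet.{u} :=
  ZFSet.range fun f : D => funCode ι (f : StrongDual ℝ X)

/-- `X_M`, the norm closure of `X ∩ M`. -/
def inducedSubspace {θ : Cardinal.{u}} (M : ElemSub θ) : Set X := closure {x : X | ι x ∈ M.sets}

/-- `D ∩ M`, for `D ⊆ X*`. -/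
def famInter (D : Set (StrongDual ℝ X)) {θ : Cardinal.{u}} (M : ElemSub θ) :
    Set (StrongDual ℝ X) :=
  {f | f ∈ D ∧ funCode ι f ∈ M.sets}

end Codes

/-! ### Notions from Banach space theory -/

section Banach

variable {X : Type u} [NormedAddCommGroup X] [NormedSpace ℝ X]

/-- The left annihilator `⊥B = {x ∈ X : b(x) = 0 for all b ∈ B}` of `B ⊆ X*`. -/
def leftAnnihilator (B : Set (StrongDual ℝ X)) : Submodule ℝ X where
  carrier := {x | ∀ b ∈ B, b x = 0}
  add_mem' := by
    intro x y hx hy b hb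
    rw [map_add, hx b hb, hy b hb, add_zero]
  zero_mem' := fun b _ => map_zero b
  smul_mem' := by
    intro c x hx b hb
    rw [map_smul, hx b hb, smul_zero]

variable (X) in
/-- `X` is weakly compactly generated: it contains a linearly dense weakly compact set. -/
def IsWCG : Prop :=
  ∃ K : Set X, IsCompact (toWeakSpace ℝ X '' K) ∧ Dense (Submodule.span ℝ K : Set X)

/-- `D ⊆ X*` is norming: `|x| = sup {|φ(x)| / ‖φ‖ : φ ∈ D \ {0}}` is an equivalent norm, that is,
`‖x‖ ≤ r |x|` for some `r` (always `|x| ≤ ‖x‖`, so that the supremum is that of a bounded set). -/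
def IsNorming (D : Set (StrongDual ℝ X)) : Prop :=
  ∃ r : ℝ, ∀ x : X, ‖x‖ ≤ r * ⨆ φ : {φ : StrongDual ℝ X // φ ∈ D ∧ φ ≠ 0}, |φ.1 x| / ‖φ.1‖

/-- `D ⊆ X*` generates projections in `X`: `D` is norming and for all big enough regular `θ` and
all countable `M ≼ H(θ)` with `D ∈ M` one has `X = X_M ⊕ ⊥(D ∩ M)`. -/
def GeneratesProjections (ι : X ↪ ZFSet.{u}) (D : Set (StrongDual ℝ X)) : Prop :=
  IsNorming D ∧
    ∃ θ₀ : Cardinal.{u}, ∀ θ : Cardinal.{u}, θ₀ < θ → θ.IsRegular →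
      ∀ M : ElemSub θ, (M : Set (hSet θ)).Countable → famCode ι D ∈ M.sets →
        ∃ Y : Submodule ℝ X, (Y : Set X) = inducedSubspace ι M ∧
          IsCompl Y (leftAnnihilator (famInter ι D M))

/-- The density of a subset `S` of a topological space: the least cardinality of a dense subset
of `S`. -/
noncomputable def dens {Z : Type u} [TopologicalSpace Z] (S : Set Z) : Cardinal.{u} :=
  sInf {c | ∃ T : Set Z, T ⊆ S ∧ S ⊆ closure T ∧ #T = c}

/-- `(P ξ)_{ξ < l}` is a projectional sequence of length `l` in `X`; only the values at `ξ < l`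
matter. -/
structure IsProjectionalSequence (l : Ordinal.{u}) (P : Ordinal.{u} → X →L[ℝ] X) : Prop where
  isLimit : Order.IsSuccLimit l
  isProj : ∀ ξ < l, P ξ ∘L P ξ = P ξ
  comp : ∀ ξ η, ξ < η → η < l → P η ∘L P ξ = P ξ ∧ P ξ ∘L P η = P ξ
  continuous_chain : ∀ δ < l, Order.IsSuccLimit δ →
    Set.range (P δ) = closure (⋃ ξ ∈ Set.Iio δ, Set.range (P ξ))
  exhausts : closure (⋃ ξ ∈ Set.Iio l, Set.range (P ξ)) = Set.univ

/-- `(P ξ)_{ξ < l}` is a projectional resolution of the identity of length `l` in `X`. -/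
structure IsPRI (l : Ordinal.{u}) (P : Ordinal.{u} → X →L[ℝ] X) : Prop
    extends IsProjectionalSequence l P where
  norm_eq_one : ∀ ξ < l, ‖P ξ‖ = 1
  dens_le : ∀ ξ < l, dens (Set.range (P ξ)) ≤ ξ.card + ℵ₀

end Banach

end WCGProj

namespace WCGProj

/-! ### Complemented subspaces from a norming family and a weakly compact set. -/

section Projection

variable {X : Type u} [NormedAddCommGroup X] [NormedSpace ℝ X]

/-! Write Y = cl A and Z = ⊥F, where A is X ∩ M and F is X* ∩ M. If F norms A with functionals of
norm at most 1, then ‖y‖ ≤ ‖y + z‖ on Y × Z (`norm_le_of_norming`), so Y ∩ Z = 0, Y + Z is closed,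
and the projection onto Y along Z has norm 1. If K ∈ M is weakly compact and p ∈ K, elementarity
puts a point of K ∩ M into every weak neighbourhood of p given by finitely many functionals of M.
Compactness of K ∩ Y then yields q ∈ Y agreeing with p on F, so p = q + (p - q) ∈ Y + Z. As K is
linearly dense, Y + Z = X (`isCompl_leftAnnihilator`).

It remains to find the right objects in M. `ElemSub.mem_sets_of_def` says that definable sets lie in
M. For (1), X* and its unit ball are definable from X (`mem_famCode_univ_iff`). For (2), M is only
known to contain X*, not the norm or the addition. Weak compactness is phrased by convergence of
ultrafilters and linear density by separation of functionals; an equivalent norm comes from a set B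
∈ M which two applications of Banach–Steinhaus show to be bounded and norming
(`exists_norming_mem_sets`); X_M is a subspace by an approximation argument
(`add_smul_mem_closure`).

For (3), submodels are replaced by hulls in X ⊕ X* under countably many finitary operations
(`exists_closing_off`). The hulls of initial segments of a dense set increase continuously, have
controlled cardinality, and satisfy the same decomposition criterion. -/

theorem continuous_weakSpace_apply (g : StrongDual ℝ X) :
    Continuous fun w : WeakSpace ℝ X => g ((toWeakSpace ℝ X).symm w) :=
  WeakBilin.eval_continuous (topDualPairing ℝ X).flip g

/-- A point of a weakly compact set `K` whose values at finitely many functionals of `F` can be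
approximated on `K ∩ Y` lies in `Y + ⊥F`. -/
theorem exists_sub_mem_leftAnnihilator {K : Set X} (hK : IsCompact (toWeakSpace ℝ X '' K))
    {Y : Submodule ℝ X} (hY : IsClosed (Y : Set X)) {F : Set (StrongDual ℝ X)} {p : X}
    (h : ∀ G : Finset (StrongDual ℝ X), ↑G ⊆ F → ∀ ε > 0,
      ∃ q ∈ K, q ∈ Y ∧ ∀ g ∈ G, |g q - g p| < ε) :
    ∃ q ∈ Y, p - q ∈ leftAnnihilator F := by
  classical
  have hYc : IsClosed (toWeakSpace ℝ X '' (Y : Set X)) := by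
    rw [← hY.closure_eq, Y.convex.toWeakSpace_closure ℝ]
    exact isClosed_closure
  -- The conditions |g w - g p| ≤ 1/(n + 1), over g ∈ F and n, are weakly closed. Finitely many are
  -- met on K ∩ Y by hypothesis, so compactness gives one point for all.
  obtain ⟨w, ⟨-, q, hq, rfl⟩, hw⟩ := (hK.inter_right hYc).inter_iInter_nonempty
    (fun i : F × ℕ => {w | |i.1.1 ((toWeakSpace ℝ X).symm w) - i.1.1 p| ≤ 1 / ((i.2 : ℝ) + 1)})
    (fun i => isClosed_le
      (((continuous_weakSpace_apply i.1.1).sub continuous_const).abs) continuous_const)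
    (fun s => by
      obtain ⟨q, hqK, hqY, hq⟩ := h (s.image fun i => i.1.1)
        (by intro g hg; simp at hg; obtain ⟨h, -⟩ := hg; exact h)
        (1 / (((s.sup fun i => i.2 : ℕ) : ℝ) + 1)) (by positivity)
      refine ⟨toWeakSpace ℝ X q, ⟨⟨q, hqK, rfl⟩, q, hqY, rfl⟩, ?_⟩
      simp only [Set.mem_iInter, Set.mem_ofPred_eq, LinearEquiv.symm_apply_apply]
      intro i hi
      refine (hq i.1.1 (Finset.mem_image_of_mem _ hi)).le.trans ?_
      have : i.2 ≤ s.sup fun i => i.2 := Finset.le_sup (f := fun i : F × ℕ => i.2) hi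
      gcongr)
  refine ⟨q, hq, fun g hg => ?_⟩
  have h0 : |g q - g p| ≤ 0 := by
    refine ge_of_tendsto' tendsto_one_div_add_atTop_nhds_zero_nat fun n => ?_
    simpa using Set.mem_iInter.1 hw (⟨g, hg⟩, n)
  rw [map_sub, ← neg_sub, neg_eq_zero]
  exact abs_eq_zero.1 (le_antisymm h0 (abs_nonneg _))

/-- Functionals of `F` that are bounded by `b` and norm `A` up to the factor `c` bound the
projection of `cl A ⊕ ⊥F` onto `cl A`. -/
theorem norm_le_of_norming {A : Set X} {F : Set (StrongDual ℝ X)} {b c : ℝ} (hc : 0 ≤ c)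
    (hb : 0 ≤ b)
    (h : ∀ x ∈ A, ∀ ε > 0, ∃ f ∈ F, ‖f‖ ≤ b ∧ ‖x‖ ≤ c * f x + ε) {x z : X}
    (hx : x ∈ closure A) (hz : z ∈ leftAnnihilator F) : ‖x‖ ≤ c * b * ‖x + z‖ := by
  refine le_of_forall_pos_le_add fun ε hε => ?_
  have hcb : 0 ≤ c * b := mul_nonneg hc hb
  -- Replacing x by x' costs ‖x - x'‖ in the norm and c * b * ‖x - x'‖ in the functional; this
  -- radius keeps the sum below ε / 2.
  obtain ⟨x', hx', hxx⟩ := Metric.mem_closure_iff.1 hx (ε / (2 * (1 + c * b))) (by positivity)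
  rw [dist_eq_norm] at hxx
  obtain ⟨f, hf, hfb, hfx⟩ := h x' hx' (ε / 2) (by positivity)
  have h1 : f x' = f (x + z) - f (x - x') := by
    rw [map_add, map_sub, hz f hf]; ring
  have h2 : f (x + z) ≤ b * ‖x + z‖ :=
    (le_abs_self _).trans ((f.le_opNorm _).trans (by gcongr))
  have h3 : -f (x - x') ≤ b * ‖x - x'‖ :=
    (neg_le_abs _).trans ((f.le_opNorm _).trans (by gcongr))
  have h4 : ‖x‖ ≤ ‖x'‖ + ‖x - x'‖ := by
    simpa using norm_add_le x' (x - x')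
  have h5 : c * f x' ≤ c * (b * ‖x + z‖ + b * ‖x - x'‖) := by
    gcongr; linarith
  have h6 : (1 + c * b) * ‖x - x'‖ ≤ ε / 2 := by
    calc _ ≤ (1 + c * b) * (ε / (2 * (1 + c * b))) := by gcongr
      _ = ε / 2 := by field_simp
  linarith

/-- The norm estimate makes the sum map Y × ⊥F → X injective and bounded below, hence of closed
range. By `exists_sub_mem_leftAnnihilator` this range contains K, whose span is dense. -/
theorem isCompl_leftAnnihilator [CompleteSpace X] {K : Set X}
    (hK : IsCompact (toWeakSpace ℝ X '' K)) (hKd : Dense (Submodule.span ℝ K : Set X))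
    {A : Set X} {Y : Submodule ℝ X} (hY : (Y : Set X) = closure A)
    {F : Set (StrongDual ℝ X)} {b c : ℝ} (hc : 0 ≤ c) (hb : 0 ≤ b)
    (hn : ∀ x ∈ A, ∀ ε > 0, ∃ f ∈ F, ‖f‖ ≤ b ∧ ‖x‖ ≤ c * f x + ε)
    (h : ∀ p ∈ K, ∀ G : Finset (StrongDual ℝ X), ↑G ⊆ F → ∀ ε > 0,
      ∃ q ∈ K, q ∈ A ∧ ∀ g ∈ G, |g q - g p| < ε) :
    IsCompl Y (leftAnnihilator F) := by
  set Z := leftAnnihilator F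
  have hYc : IsClosed (Y : Set X) := hY ▸ isClosed_closure
  have hZc : IsClosed (Z : Set X) := by
    have : (Z : Set X) = ⋂ f ∈ F, {x | f x = 0} := by
      ext x; simp only [Set.mem_iInter]; rfl
    rw [this]
    exact isClosed_biInter fun f _ => isClosed_eq f.continuous continuous_const
  have hcb : 0 ≤ c * b := mul_nonneg hc hb
  have key : ∀ y ∈ Y, ∀ z ∈ Z, ‖y‖ ≤ c * b * ‖y + z‖ := fun y hy z hz =>
    norm_le_of_norming hc hb hn (hY ▸ hy) hz
  refine ⟨disjoint_iff.2 (Submodule.eq_bot_iff _ |>.2 ?_), codisjoint_iff.2 ?_⟩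
  · rintro x ⟨hx, hx'⟩
    have := key x hx (-x) (Z.neg_mem hx')
    simpa using this
  · have : CompleteSpace Y := hYc.completeSpace_coe
    have : CompleteSpace Z := hZc.completeSpace_coe
    let T : Y × Z →L[ℝ] X := Y.subtypeL.coprod Z.subtypeL
    have hT : ∀ v, T v = v.1 + v.2 := fun v => by simp [T]
    have hanti : AntilipschitzWith ⟨c * b + 1, by positivity⟩ T := by
      refine T.antilipschitz_of_bound fun v => ?_
      have h1 := key v.1 v.1.2 v.2 v.2.2
      have h2 : ‖(v.2 : X)‖ ≤ ‖(v.1 : X)‖ + ‖(v.1 + v.2 : X)‖ := by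
        have := norm_sub_le (v.1 + v.2 : X) v.1
        rw [add_sub_cancel_left] at this
        linarith
      rw [Prod.norm_def, hT]
      have h3 : 0 ≤ ‖(v.1 + v.2 : X)‖ := norm_nonneg _
      refine max_le ?_ ?_
      · change ‖(v.1 : X)‖ ≤ (c * b + 1) * _
        linarith
      · change ‖(v.2 : X)‖ ≤ (c * b + 1) * _
        linarith
    have hr : IsClosed (Set.range T) := hanti.isClosed_range T.uniformContinuous
    have hsup : ((Y ⊔ Z : Submodule ℝ X) : Set X) = Set.range T := by
      ext x
      simp only [SetLike.mem_coe, Submodule.mem_sup, Set.mem_range, hT, Prod.exists,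
        Subtype.exists, exists_prop]
    have hKs : Submodule.span ℝ K ≤ Y ⊔ Z := by
      refine Submodule.span_le.2 fun p hp => ?_
      obtain ⟨q, hq, hpq⟩ := exists_sub_mem_leftAnnihilator hK hYc fun G hG ε hε => by
        obtain ⟨q, h1, h2, h3⟩ := h p hp G hG ε hε
        exact ⟨q, h1, (hY ▸ subset_closure h2 : q ∈ (Y : Set X)), h3⟩
      exact Submodule.mem_sup.2 ⟨q, hq, p - q, hpq, by simp⟩
    refine SetLike.coe_injective ?_
    rw [Submodule.top_coe, ← hKd.closure_eq]
    refine subset_antisymm (fun x _ => hKd x) ?_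
    rw [hsup]
    exact closure_minimal (hsup ▸ hKs) hr

/-- `norm_le_of_norming` with b = c = 1 bounds the algebraic projection by 1; a nonzero fixed point
in A shows that the norm is not smaller. -/
theorem exists_projection {A : Set X} {Y : Submodule ℝ X} (hY : (Y : Set X) = closure A)
    {F : Set (StrongDual ℝ X)} (hYF : IsCompl Y (leftAnnihilator F))
    (hA : ∃ x ∈ A, x ≠ 0)
    (hn : ∀ x ∈ A, ∀ ε > 0, ∃ f ∈ F, ‖f‖ ≤ 1 ∧ ‖x‖ ≤ f x + ε) :
    ∃ P : X →L[ℝ] X, P ∘L P = P ∧ ‖P‖ = 1 ∧ Set.range P = closure A ∧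
      P.ker = leftAnnihilator F := by
  let P₀ : X →ₗ[ℝ] X := Submodule.projection Y (leftAnnihilator F) hYF
  have hP : ∀ x, ‖P₀ x‖ ≤ 1 * ‖x‖ := fun x => by
    have h1 : P₀ x ∈ Y := Submodule.projection_apply_mem hYF x
    have h2 : x - P₀ x ∈ leftAnnihilator F :=
      (Submodule.ker_projection hYF).le <| LinearMap.mem_ker.2 <| by
        rw [map_sub, sub_eq_zero]
        exact (Submodule.projection_apply_left hYF ⟨P₀ x, h1⟩).symm
    have := norm_le_of_norming zero_le_one zero_le_one
      (by simpa only [one_mul] using hn) (x := P₀ x) (by rw [← hY]; exact h1) h2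
    simpa using this
  let P : X →L[ℝ] X := P₀.mkContinuous 1 hP
  have hPP : ∀ y ∈ Y, P y = y := fun y hy => Submodule.projection_apply_left hYF ⟨y, hy⟩
  have hPY : ∀ x, P x ∈ Y := fun x => Submodule.projection_apply_mem hYF x
  refine ⟨P, ?_, le_antisymm (P₀.mkContinuous_norm_le zero_le_one hP) ?_, ?_, ?_⟩
  · ext x; exact hPP _ (hPY x)
  · obtain ⟨x, hx, hx0⟩ := hA
    have h1 := P.le_opNorm x
    rw [hPP x (hY ▸ subset_closure hx : x ∈ (Y : Set X))] at h1
    exact le_of_mul_le_mul_right (by simpa using h1) (norm_pos_iff.2 hx0)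
  · rw [← hY]
    refine subset_antisymm (Set.range_subset_iff.2 hPY) fun y hy => ⟨y, hPP y hy⟩
  · exact Submodule.ker_projection hYF

end Projection

/-! ### Definability over H(θ) and elementarity. -/

section ElementarySubmodels

variable {θ : Cardinal.{u}}

theorem hSet_transitive {x y : ZFSet.{u}} (hx : x ∈ hSet θ) (hy : y ∈ x) : y ∈ hSet θ :=
  (mk_le_of_injective (f := fun z : {z // Relation.TransGen (fun a b : ZFSet.{u} => a ∈ b) z y} =>
    (⟨z.1, z.2.tail hy⟩ : {z // Relation.TransGen (fun a b : ZFSet.{u} => a ∈ b) z x}))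
    fun _ _ h => Subtype.ext (congrArg (fun t => t.1) h)).trans_lt hx

theorem hSet_of_subset {x y : ZFSet.{u}} (hx : x ∈ hSet θ) (hy : y ⊆ x) : y ∈ hSet θ := by
  refine (mk_le_of_injective
    (f := fun z : {z // Relation.TransGen (fun a b : ZFSet.{u} => a ∈ b) z y} =>
    (⟨z.1, ?_⟩ : {z // Relation.TransGen (fun a b : ZFSet.{u} => a ∈ b) z x}))
    fun _ _ h => Subtype.ext (congrArg (fun t => t.1) h)).trans_lt hx
  obtain ⟨w, hw, hwy⟩ := (Relation.TransGen.tail'_iff).1 z.2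
  exact Relation.TransGen.tail' hw (hy hwy)

/-- The transitive closure of x lies in the von Neumann stage of its rank, so it is small and has a
cardinality in universe `u`. -/
theorem exists_forall_mem_hSet (x : ZFSet.{u}) :
    ∃ θ₀ : Cardinal.{u}, ∀ θ, θ₀ < θ → x ∈ hSet θ := by
  have hsub : {y : ZFSet.{u} | Relation.TransGen (fun a b => a ∈ b) y x} ⊆
      (ZFSet.vonNeumann x.rank : Set ZFSet.{u}) := by
    intro y hy
    refine ZFSet.mem_vonNeumann.2 ?_
    induction hy using Relation.TransGen.head_induction_on with
    | single h => exact ZFSet.rank_lt_of_mem h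
    | head h _ ih => exact (ZFSet.rank_lt_of_mem h).trans ih
  have : Small.{u} {y : ZFSet.{u} // Relation.TransGen (fun a b => a ∈ b) y x} :=
    have := ZFSet.small_coe (ZFSet.vonNeumann x.rank)
    small_subset hsub
  refine ⟨#(Shrink.{u} {y : ZFSet.{u} // Relation.TransGen (fun a b => a ∈ b) y x}), fun θ h => ?_⟩
  have h1 := Cardinal.lift_mk_eq'.2 ⟨equivShrink
    {y : ZFSet.{u} // Relation.TransGen (fun a b => a ∈ b) y x}⟩
  rw [Cardinal.lift_id'.{u, u + 1}] at h1
  change #_ < _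
  rw [h1]
  exact Cardinal.lift_lt.2 h

/-- `P` is first-order definable over `H(θ)` with parameters from `M`. -/
def DefM (M : ElemSub θ) {α : Type} (P : (α → hSet θ) → Prop) : Prop :=
  ∃ φ : setLang.Formula (α ⊕ M), ∀ v, φ.Realize (Sum.elim v (fun m => (m : hSet θ))) ↔ P v

/-- `t` is a variable or a parameter from `M`. -/
def IsTerm (M : ElemSub θ) {α : Type} (t : (α → hSet θ) → hSet θ) : Prop :=
  ∃ s : α ⊕ M, ∀ v, Sum.elim v (fun m : M => (m : hSet θ)) s = t v

variable {M : ElemSub θ} {α : Type}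

theorem IsTerm.var (a : α) : IsTerm M fun v => v a := ⟨.inl a, fun _ => rfl⟩

theorem IsTerm.const {m : hSet θ} (hm : m ∈ M) : IsTerm M fun _ : α → hSet θ => m :=
  ⟨.inr ⟨m, hm⟩, fun _ => rfl⟩

namespace DefM

theorem congr {P Q : (α → hSet θ) → Prop} (hQ : DefM M Q) (h : ∀ v, P v ↔ Q v) : DefM M P := by
  obtain ⟨φ, hφ⟩ := hQ
  exact ⟨φ, fun v => (hφ v).trans (h v).symm⟩

theorem mem {s t : (α → hSet θ) → hSet θ} (hs : IsTerm M s) (ht : IsTerm M t) :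
    DefM M fun v => (s v : ZFSet) ∈ (t v : ZFSet) := by
  obtain ⟨a, ha⟩ := hs
  obtain ⟨b, hb⟩ := ht
  refine ⟨FirstOrder.Language.Relations.formula₂ (L := setLang) SetRel.mem
    (FirstOrder.Language.var a) (FirstOrder.Language.var b), fun v => ?_⟩
  refine FirstOrder.Language.Formula.realize_rel₂.trans ?_
  simp only [FirstOrder.Language.Term.realize_var, ← ha, ← hb]
  rfl

theorem eq {s t : (α → hSet θ) → hSet θ} (hs : IsTerm M s) (ht : IsTerm M t) :
    DefM M fun v => s v = t v := by
  obtain ⟨a, ha⟩ := hs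
  obtain ⟨b, hb⟩ := ht
  refine ⟨FirstOrder.Language.Term.equal
    (FirstOrder.Language.var a) (FirstOrder.Language.var b), fun v => ?_⟩
  rw [FirstOrder.Language.Formula.realize_equal]
  simp only [FirstOrder.Language.Term.realize_var, ← ha, ← hb]

theorem and {P Q : (α → hSet θ) → Prop} (hP : DefM M P) (hQ : DefM M Q) :
    DefM M fun v => P v ∧ Q v := by
  obtain ⟨φ, hφ⟩ := hP
  obtain ⟨ψ, hψ⟩ := hQ
  exact ⟨φ ⊓ ψ, fun v => by rw [FirstOrder.Language.Formula.realize_inf, hφ, hψ]⟩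

theorem not {P : (α → hSet θ) → Prop} (hP : DefM M P) : DefM M fun v => ¬ P v := by
  obtain ⟨φ, hφ⟩ := hP
  exact ⟨φ.not, fun v => by rw [FirstOrder.Language.Formula.realize_not, hφ]⟩

theorem imp {P Q : (α → hSet θ) → Prop} (hP : DefM M P) (hQ : DefM M Q) :
    DefM M fun v => P v → Q v :=
  (hP.and hQ.not).not.congr fun v => by tauto

theorem or {P Q : (α → hSet θ) → Prop} (hP : DefM M P) (hQ : DefM M Q) :
    DefM M fun v => P v ∨ Q v :=
  (hP.not.and hQ.not).not.congr fun v => by tauto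

theorem iff {P Q : (α → hSet θ) → Prop} (hP : DefM M P) (hQ : DefM M Q) :
    DefM M fun v => P v ↔ Q v :=
  ((hP.imp hQ).and (hQ.imp hP)).congr fun v => by tauto

/-- The bound variable is the new element `none` of `Option α`; this convention lets nested
quantifiers be handled by unification. -/
theorem ex {P : (α → hSet θ) → hSet θ → Prop}
    (hP : DefM M fun v : Option α → hSet θ => P (fun a => v (some a)) (v none)) :
    DefM M fun v => ∃ x, P v x := by
  obtain ⟨φ, hφ⟩ := hP
  let r : Option α ⊕ M → (α ⊕ M) ⊕ Unit
    | .inl none => .inr ()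
    | .inl (some a) => .inl (.inl a)
    | .inr m => .inl (.inr m)
  refine ⟨(φ.relabel r).iExs Unit, fun v => ?_⟩
  rw [FirstOrder.Language.Formula.realize_iExs]
  have key : ∀ x : hSet θ, (φ.relabel r).Realize
      (Sum.elim (Sum.elim v (fun m => (m : hSet θ))) (fun _ : Unit => x)) ↔ P v x := by
    intro x
    rw [FirstOrder.Language.Formula.realize_relabel]
    refine Iff.trans (iff_of_eq (congrArg _ (funext ?_))) (hφ fun o => o.elim x v)
    rintro ((_ | a) | m) <;> rfl
  exact ⟨fun ⟨i, hi⟩ => ⟨i (), (key _).1 hi⟩, fun ⟨x, hx⟩ => ⟨fun _ => x, (key x).2 hx⟩⟩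

theorem all {P : (α → hSet θ) → hSet θ → Prop}
    (hP : DefM M fun v : Option α → hSet θ => P (fun a => v (some a)) (v none)) :
    DefM M fun v => ∀ x, P v x :=
  (DefM.ex (P := fun v x => ¬ P v x) hP.not).not.congr fun v => by simp

end DefM

/-- The Tarski–Vaught property of `M ≼ H(θ)`. -/
theorem ElemSub.exists_mem (M : ElemSub θ) {P : hSet θ → Prop}
    (hP : DefM M fun v : Unit → hSet θ => P (v ())) (h : ∃ x, P x) : ∃ x ∈ M, P x := by
  obtain ⟨φ, hφ⟩ := hP
  let r : Unit ⊕ M → M ⊕ Unit := Sum.swap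
  have key : ∀ x : hSet θ, (φ.relabel r).Realize
      (Sum.elim (fun m : M => (m : hSet θ)) (fun _ : Unit => x)) ↔ P x := by
    intro x
    rw [FirstOrder.Language.Formula.realize_relabel]
    refine Iff.trans (iff_of_eq (congrArg _ (funext ?_))) (hφ fun _ => x)
    rintro (a | m) <;> rfl
  obtain ⟨x, hx⟩ := h
  have h1 : ((φ.relabel r).iExs Unit).Realize (M.subtype ∘ (id : M → M)) :=
    FirstOrder.Language.Formula.realize_iExs.2 ⟨fun _ => x, (key x).2 hx⟩
  -- Elementarity moves the existential statement down to M; the witness found there is moved back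
  -- up to H(θ).
  rw [M.subtype.map_formula, FirstOrder.Language.Formula.realize_iExs] at h1
  obtain ⟨i, hi⟩ := h1
  rw [← M.subtype.map_formula] at hi
  refine ⟨i (), (i ()).2, (key _).1 ?_⟩
  convert hi using 1
  funext s
  rcases s with m | a <;> rfl

theorem IsTerm.lift {t : (α → hSet θ) → hSet θ} (ht : IsTerm M t) :
    IsTerm M fun v : Option α → hSet θ => t fun a => v (some a) := by
  obtain ⟨s, hs⟩ := ht
  refine ⟨s.map some id, fun v => Eq.trans ?_ (hs _)⟩
  rcases s with a | m <;> rfl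

variable (M) in
theorem ElemSub.mem_sets {x : hSet θ} : (x : ZFSet) ∈ M.sets ↔ x ∈ M := by
  constructor
  · rintro ⟨y, hy, h⟩
    rwa [← Subtype.ext h]
  · exact fun h => ⟨x, h, rfl⟩

theorem ElemSub.mem_hSet {x : ZFSet.{u}} (hx : x ∈ M.sets) : x ∈ hSet θ := by
  obtain ⟨y, -, rfl⟩ := hx
  exact y.2

theorem ElemSub.exists_mem_sets {P : ZFSet.{u} → Prop}
    (hP : DefM M fun v : Unit → hSet θ => P (v ())) {x : ZFSet.{u}} (hx : x ∈ hSet θ) (h : P x) :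
    ∃ y ∈ M.sets, P y := by
  obtain ⟨y, hy, h⟩ := M.exists_mem (P := fun y => P y) hP ⟨⟨x, hx⟩, h⟩
  exact ⟨y, M.mem_sets.2 hy, h⟩

namespace DefM

variable {s t r p : (α → hSet θ) → hSet θ}

theorem eqVal (hs : IsTerm M s) (ht : IsTerm M t) :
    DefM M fun v => (s v : ZFSet) = (t v : ZFSet) :=
  (DefM.eq hs ht).congr fun _ => Subtype.ext_iff.symm

theorem exH {P : (α → hSet θ) → ZFSet.{u} → Prop}
    (hP : DefM M fun v : Option α → hSet θ => P (fun a => v (some a)) (v none)) :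
    DefM M fun v => ∃ x ∈ hSet θ, P v x :=
  (DefM.ex (P := fun v x => P v x) hP).congr fun v => by simp

theorem allH {P : (α → hSet θ) → ZFSet.{u} → Prop}
    (hP : DefM M fun v : Option α → hSet θ => P (fun a => v (some a)) (v none)) :
    DefM M fun v => ∀ x ∈ hSet θ, P v x :=
  (DefM.all (P := fun v x => P v x) hP).congr fun v => by simp

/-- Since H(θ) is transitive, a quantifier bounded by a member of H(θ) ranges only over H(θ). -/
theorem bex {P : (α → hSet θ) → ZFSet.{u} → Prop} (ht : IsTerm M t)
    (hP : DefM M fun v : Option α → hSet θ => P (fun a => v (some a)) (v none)) :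
    DefM M fun v => ∃ x ∈ (t v : ZFSet), P v x :=
  (DefM.exH ((DefM.mem (IsTerm.var none) ht.lift).and hP)
    (P := fun v x => x ∈ (t v : ZFSet) ∧ P v x)).congr fun v =>
    ⟨fun ⟨x, hx, h⟩ => ⟨x, hSet_transitive (t v).2 hx, hx, h⟩, fun ⟨x, _, hx, h⟩ => ⟨x, hx, h⟩⟩

theorem ball {P : (α → hSet θ) → ZFSet.{u} → Prop} (ht : IsTerm M t)
    (hP : DefM M fun v : Option α → hSet θ => P (fun a => v (some a)) (v none)) :
    DefM M fun v => ∀ x ∈ (t v : ZFSet), P v x :=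
  (DefM.bex (P := fun v x => ¬ P v x) ht hP.not).not.congr fun v => by simp

theorem subset (hs : IsTerm M s) (ht : IsTerm M t) :
    DefM M fun v => (s v : ZFSet) ⊆ (t v : ZFSet) :=
  DefM.ball (P := fun v x => x ∈ (t v : ZFSet)) hs (DefM.mem (IsTerm.var none) ht.lift)

theorem eqUPair (hp : IsTerm M p) (hs : IsTerm M s) (ht : IsTerm M t) :
    DefM M fun v => (p v : ZFSet) = {(s v : ZFSet), (t v : ZFSet)} :=
  (((DefM.mem hs hp).and (DefM.mem ht hp)).and (DefM.ball
    (P := fun v x => x = (s v : ZFSet) ∨ x = (t v : ZFSet)) hp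
    ((DefM.eqVal (IsTerm.var none) hs.lift).or (DefM.eqVal (IsTerm.var none) ht.lift)))).congr
    fun v => by
      constructor
      · intro h; rw [h]; simp
      · rintro ⟨⟨h1, h2⟩, h3⟩
        ext z
        rw [ZFSet.mem_pair]
        exact ⟨h3 z, fun h => h.elim (fun h => h ▸ h1) fun h => h ▸ h2⟩

/-- Both components {s}, written {s, s}, and {s, t} of a Kuratowski pair are elements of p, so
quantifiers bounded by p suffice. -/
theorem eqPair (hp : IsTerm M p) (hs : IsTerm M s) (ht : IsTerm M t) :
    DefM M fun v => (p v : ZFSet) = ZFSet.pair (s v) (t v) := by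
  refine (DefM.bex (P := fun v a => a = {(s v : ZFSet), (s v : ZFSet)} ∧
    ∃ b ∈ (p v : ZFSet), b = {(s v : ZFSet), (t v : ZFSet)} ∧ (p v : ZFSet) = {a, b}) hp
    ((DefM.eqUPair (IsTerm.var none) hs.lift hs.lift).and
      (DefM.bex (P := fun v b => b = {(s fun a => v (some a) : ZFSet), (t fun a => v (some a) : ZFSet)} ∧
        (p fun a => v (some a) : ZFSet) = {(v none : ZFSet), b}) hp.lift
        ((DefM.eqUPair (IsTerm.var none) hs.lift.lift ht.lift.lift).and
          (DefM.eqUPair hp.lift.lift (IsTerm.var (some none)) (IsTerm.var none)))))).congr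
    fun v => ?_
  constructor
  · intro h
    refine ⟨{(s v : ZFSet), (s v : ZFSet)}, ?_, rfl, {(s v : ZFSet), (t v : ZFSet)}, ?_, rfl, ?_⟩ <;>
      rw [h] <;> simp [ZFSet.pair]
  · rintro ⟨a, -, rfl, b, -, rfl, h⟩
    rw [h]
    simp [ZFSet.pair]

theorem pairMem (hs : IsTerm M s) (ht : IsTerm M t) (hp : IsTerm M p) :
    DefM M fun v => ZFSet.pair (s v) (t v) ∈ (p v : ZFSet) :=
  (DefM.bex (P := fun v a => a = ZFSet.pair (s v) (t v)) hp
    (DefM.eqPair (IsTerm.var none) hs.lift ht.lift)).congr fun v => by simp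

end DefM

theorem hSet_of_pair {x y : ZFSet.{u}} (h : ZFSet.pair x y ∈ hSet θ) : x ∈ hSet θ ∧ y ∈ hSet θ := by
  have h1 : ({x, y} : ZFSet) ∈ hSet θ := hSet_transitive h (by simp [ZFSet.pair])
  exact ⟨hSet_transitive h1 (by simp), hSet_transitive h1 (by simp)⟩

theorem DefM.pairPairMem {r s t p : (α → hSet θ) → hSet θ} (hr : IsTerm M r) (hs : IsTerm M s)
    (ht : IsTerm M t) (hp : IsTerm M p) :
    DefM M fun v => ZFSet.pair (ZFSet.pair (r v) (s v)) (t v) ∈ (p v : ZFSet) :=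
  (DefM.exH (P := fun v a => a = ZFSet.pair (r v) (s v) ∧ ZFSet.pair a (t v) ∈ (p v : ZFSet))
    ((DefM.eqPair (IsTerm.var none) hr.lift hs.lift).and
      (DefM.pairMem (IsTerm.var none) ht.lift hp.lift))).congr fun v =>
    ⟨fun h => ⟨_, (hSet_of_pair (hSet_transitive (p v).2 h)).1, rfl, h⟩,
      fun ⟨_, _, h, h'⟩ => h ▸ h'⟩

/-- A set in `H(θ)` whose elements are definable belongs to `M`. -/
theorem ElemSub.mem_sets_of_def {S : ZFSet.{u}} (hS : S ∈ hSet θ) {Q : ZFSet.{u} → Prop}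
    (hQ : DefM M fun v : Option Unit → hSet θ => Q (v none))
    (h : ∀ x ∈ hSet θ, x ∈ S ↔ Q x) : S ∈ M.sets := by
  -- Some y ∈ M has the same elements as S within H(θ); by transitivity neither set has others, so y
  -- = S.
  obtain ⟨y, hy, h'⟩ := M.exists_mem_sets (P := fun y => ∀ x ∈ hSet θ, x ∈ y ↔ Q x)
    (DefM.allH ((DefM.mem (IsTerm.var none) (IsTerm.var (some ()))).iff hQ)) hS h
  convert hy
  ext z
  exact ⟨fun hz => (h' z (hSet_transitive hS hz)).2 ((h z (hSet_transitive hS hz)).1 hz),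
    fun hz => (h z (hSet_transitive (M.mem_hSet hy) hz)).2
      ((h' z (hSet_transitive (M.mem_hSet hy) hz)).1 hz)⟩

theorem ElemSub.pair_mem_sets {x y : ZFSet.{u}} (h : ZFSet.pair x y ∈ hSet θ) (hx : x ∈ M.sets)
    (hy : y ∈ M.sets) : ZFSet.pair x y ∈ M.sets := by
  obtain ⟨x, hx, rfl⟩ := hx
  obtain ⟨y, hy, rfl⟩ := hy
  obtain ⟨p, hp, rfl⟩ := M.exists_mem_sets (P := fun p => p = ZFSet.pair x y)
    (DefM.eqPair (IsTerm.var ()) (IsTerm.const hx) (IsTerm.const hy)) h rfl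
  exact hp

/-- Each coordinate is the unique object satisfying a formula with the pair as parameter. -/
theorem ElemSub.of_pair_mem_sets {x y : ZFSet.{u}} (h : ZFSet.pair x y ∈ M.sets) :
    x ∈ M.sets ∧ y ∈ M.sets := by
  have hH := hSet_of_pair (M.mem_hSet h)
  obtain ⟨p, hp, hpv⟩ := h
  obtain ⟨x', hx', y', -, h1⟩ := M.exists_mem_sets
    (P := fun x => ∃ y ∈ hSet θ, (p : ZFSet) = ZFSet.pair x y)
    (DefM.exH (DefM.eqPair (IsTerm.const hp) (IsTerm.var (some ())) (IsTerm.var none)))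
    hH.1 ⟨y, hH.2, hpv⟩
  obtain ⟨y'', hy'', x'', -, h2⟩ := M.exists_mem_sets
    (P := fun y => ∃ x ∈ hSet θ, (p : ZFSet) = ZFSet.pair x y)
    (DefM.exH (DefM.eqPair (IsTerm.const hp) (IsTerm.var none) (IsTerm.var (some ()))))
    hH.2 ⟨x, hH.1, hpv⟩
  rw [hpv, ZFSet.pair_inj] at h1 h2
  exact ⟨h1.1 ▸ hx', h2.2 ▸ hy''⟩

end ElementarySubmodels

/-! ### Formal fractions and Dedekind cuts. -/

section Fractions

theorem natCode_mem_of_lt {m n : ℕ} (h : m < n) : natCode.{u} m ∈ natCode.{u} n := by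
  induction n with
  | zero => omega
  | succ n ih =>
    rw [natCode, ZFSet.mem_insert_iff]
    rcases Nat.lt_succ_iff_lt_or_eq.1 h with h | rfl
    · exact .inr (ih h)
    · exact .inl rfl

theorem natCode_injective : Function.Injective natCode.{u} := by
  intro m n h
  rcases lt_trichotomy m n with h' | h' | h'
  · exact absurd (h ▸ natCode_mem_of_lt h') (ZFSet.mem_irrefl _)
  · exact h'
  · exact absurd (h ▸ natCode_mem_of_lt h') (ZFSet.mem_irrefl _)

/-- The formal fraction `(a - b) / (c + 1)` as a set. -/
noncomputable def fracCode (t : ℕ × ℕ × ℕ) : ZFSet.{u} :=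
  ZFSet.pair (natCode t.1) (ZFSet.pair (natCode t.2.1) (natCode t.2.2))

/-- The value of a formal fraction. -/
noncomputable def fracVal (t : ℕ × ℕ × ℕ) : ℝ := ((t.1 : ℝ) - (t.2.1 : ℝ)) / ((t.2.2 : ℝ) + 1)

theorem fracCode_injective : Function.Injective fracCode.{u} := by
  rintro ⟨a, b, c⟩ ⟨a', b', c'⟩ h
  simp only [fracCode, ZFSet.pair_inj, natCode_injective.eq_iff] at h
  obtain ⟨rfl, rfl, rfl⟩ := h
  rfl

theorem mem_realCode {r : ℝ} {z : ZFSet.{u}} :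
    z ∈ realCode r ↔ ∃ t, fracVal t < r ∧ fracCode t = z := by
  simp only [realCode, ZFSet.mem_range, Subtype.exists, exists_prop]
  rfl

theorem fracCode_mem_realCode {r : ℝ} {t : ℕ × ℕ × ℕ} :
    fracCode.{u} t ∈ realCode r ↔ fracVal t < r := by
  rw [mem_realCode]
  exact ⟨fun ⟨s, h, e⟩ => fracCode_injective e ▸ h, fun h => ⟨t, h, rfl⟩⟩

theorem exists_fracVal_between {a b : ℝ} (h : a < b) : ∃ t, a < fracVal t ∧ fracVal t < b := by
  obtain ⟨q, h1, h2⟩ := exists_rat_btwn h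
  -- The numerator is split into positive and negative parts; the denominator is stored shifted by
  -- one.
  refine ⟨(q.num.toNat, (-q.num).toNat, q.den - 1), ?_⟩
  have hq : fracVal (q.num.toNat, (-q.num).toNat, q.den - 1) = q := by
    have e1 : ((q.num.toNat : ℝ) - ((-q.num).toNat : ℝ)) = q.num := by
      have := Int.toNat_sub_toNat_neg q.num
      exact_mod_cast this
    have e2 : ((q.den - 1 : ℕ) : ℝ) + 1 = q.den := by
      have := q.den_pos
      exact_mod_cast Nat.sub_add_cancel this
    rw [fracVal, e1, e2]
    exact (Rat.cast_def q).symm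
  rw [hq]
  exact ⟨h1, h2⟩

theorem realCode_subset {r s : ℝ} : realCode.{u} r ⊆ realCode s ↔ r ≤ s := by
  constructor
  · intro h
    by_contra! hlt
    obtain ⟨t, h1, h2⟩ := exists_fracVal_between hlt
    exact h1.not_ge (fracCode_mem_realCode.1 (h (fracCode_mem_realCode.2 h2))).le
  · intro h z hz
    obtain ⟨t, ht, rfl⟩ := mem_realCode.1 hz
    exact fracCode_mem_realCode.2 (ht.trans_le h)

theorem realCode_injective : Function.Injective realCode.{u} := fun r s h =>
  le_antisymm (realCode_subset.1 (by rw [h])) (realCode_subset.1 (by rw [h]))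

/-- The set of all formal fractions. -/
noncomputable def fracSet : ZFSet.{u} := ZFSet.range fracCode.{u}

theorem fracCode_mem_fracSet (t : ℕ × ℕ × ℕ) : fracCode.{u} t ∈ fracSet.{u} :=
  ZFSet.mem_range.2 ⟨t, rfl⟩

end Fractions

/-- `t` belongs to the value at `x` of the function with graph `f`. -/
def ValMem (t f x : ZFSet.{u}) : Prop := ∃ r, ZFSet.pair x r ∈ f ∧ t ∈ r

theorem DefM.valMem {θ : Cardinal.{u}} {M : ElemSub θ} {α : Type}
    {t f x : (α → hSet θ) → hSet θ} (ht : IsTerm M t) (hf : IsTerm M f) (hx : IsTerm M x) :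
    DefM M fun v => ValMem (t v) (f v) (x v) :=
  (DefM.exH (P := fun v r => ZFSet.pair (x v) r ∈ (f v : ZFSet) ∧ (t v : ZFSet) ∈ r)
    ((DefM.pairMem hx.lift (IsTerm.var none) hf.lift).and
      (DefM.mem ht.lift (IsTerm.var none)))).congr fun v =>
    ⟨fun ⟨r, h1, h2⟩ => ⟨r, (hSet_of_pair (hSet_transitive (f v).2 h1)).2, h1, h2⟩,
      fun ⟨r, _, h1, h2⟩ => ⟨r, h1, h2⟩⟩

/-! ### Sets of points and functionals inside set theory. -/

section Points

variable {X : Type u} {ι : X ↪ ZFSet.{u}}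

variable (ι) in
/-- A subset of `X` as a set. -/
noncomputable def subCode (S : Set X) : ZFSet.{u} := ZFSet.range fun x : S => ι x

theorem mem_subCode {S : Set X} {z : ZFSet.{u}} : z ∈ subCode ι S ↔ ∃ x ∈ S, ι x = z := by
  simp [subCode]

theorem coe_mem_subCode {S : Set X} {x : X} : ι x ∈ subCode ι S ↔ x ∈ S := by
  simp [mem_subCode]

theorem mem_carrierCode {z : ZFSet.{u}} : z ∈ carrierCode ι ↔ ∃ x, ι x = z := by
  simp [carrierCode]

theorem coe_mem_carrierCode (x : X) : ι x ∈ carrierCode ι := mem_carrierCode.2 ⟨x, rfl⟩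

theorem subCode_univ : subCode ι Set.univ = carrierCode ι := by
  ext z; simp [mem_subCode, mem_carrierCode]

theorem subCode_subset {S T : Set X} : subCode ι S ⊆ subCode ι T ↔ S ⊆ T := by
  constructor
  · exact fun h x hx => coe_mem_subCode.1 (h (coe_mem_subCode.2 hx))
  · intro h z hz
    obtain ⟨x, hx, rfl⟩ := mem_subCode.1 hz
    exact coe_mem_subCode.2 (h hx)

theorem eq_subCode {K : ZFSet.{u}} (h : K ⊆ carrierCode ι) : K = subCode ι {x | ι x ∈ K} := by
  ext z
  constructor
  · intro hz
    obtain ⟨x, rfl⟩ := mem_carrierCode.1 (h hz)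
    exact coe_mem_subCode.2 hz
  · intro hz
    obtain ⟨x, hx, rfl⟩ := mem_subCode.1 hz
    exact hx

theorem forall_mem_subCode {S : Set X} {P : ZFSet.{u} → Prop} :
    (∀ z ∈ subCode ι S, P z) ↔ ∀ x ∈ S, P (ι x) := by
  simp [mem_subCode]

theorem exists_mem_subCode {S : Set X} {P : ZFSet.{u} → Prop} :
    (∃ z ∈ subCode ι S, P z) ↔ ∃ x ∈ S, P (ι x) := by
  simp [mem_subCode]

theorem forall_mem_carrierCode {P : ZFSet.{u} → Prop} :
    (∀ z ∈ carrierCode ι, P z) ↔ ∀ x : X, P (ι x) := by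
  simp [mem_carrierCode]

end Points

section Codes

variable {X : Type u} [NormedAddCommGroup X] [NormedSpace ℝ X] {ι : X ↪ ZFSet.{u}}

theorem pair_mem_funCode {f : StrongDual ℝ X} {x : X} {z : ZFSet.{u}} :
    ZFSet.pair (ι x) z ∈ funCode ι f ↔ z = realCode (f x) := by
  simp only [funCode, ZFSet.mem_range, ZFSet.pair_inj, ι.injective.eq_iff]
  exact ⟨fun ⟨y, h, e⟩ => h ▸ e.symm, fun h => ⟨x, rfl, h.symm⟩⟩

theorem valMem_funCode {f : StrongDual ℝ X} {x : X} {t : ZFSet.{u}} :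
    ValMem t (funCode ι f) (ι x) ↔ t ∈ realCode (f x) := by
  simp [ValMem, pair_mem_funCode]

/-- Values of functionals enter formulas through such comparisons with fractions, so no arithmetic
of cuts has to be coded. -/
theorem valMem_fracCode {f : StrongDual ℝ X} {x : X} {t : ℕ × ℕ × ℕ} :
    ValMem (fracCode t) (funCode ι f) (ι x) ↔ fracVal t < f x := by
  rw [valMem_funCode, fracCode_mem_realCode]

theorem funCode_injective : Function.Injective (funCode ι : StrongDual ℝ X → ZFSet.{u}) := by
  intro f g h
  ext x
  have : ZFSet.pair (ι x) (realCode (f x)) ∈ funCode ι g := h ▸ pair_mem_funCode.2 rfl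
  exact realCode_injective (pair_mem_funCode.1 this)

theorem mem_famCode {G : Set (StrongDual ℝ X)} {z : ZFSet.{u}} :
    z ∈ famCode ι G ↔ ∃ f ∈ G, funCode ι f = z := by
  simp [famCode]

theorem coe_mem_famCode {G : Set (StrongDual ℝ X)} {f : StrongDual ℝ X} :
    funCode ι f ∈ famCode ι G ↔ f ∈ G := by
  simp [mem_famCode, funCode_injective.eq_iff]

theorem eq_famCode {B : ZFSet.{u}} (h : B ⊆ famCode ι Set.univ) :
    B = famCode ι {f | funCode ι f ∈ B} := by
  ext z
  constructor
  · intro hz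
    obtain ⟨x, -, rfl⟩ := mem_famCode.1 (h hz)
    exact coe_mem_famCode.2 hz
  · intro hz
    obtain ⟨x, hx, rfl⟩ := mem_famCode.1 hz
    exact hx

theorem forall_mem_famCode {G : Set (StrongDual ℝ X)} {P : ZFSet.{u} → Prop} :
    (∀ z ∈ famCode ι G, P z) ↔ ∀ f ∈ G, P (funCode ι f) := by
  simp [mem_famCode]

theorem exists_mem_famCode {G : Set (StrongDual ℝ X)} {P : ZFSet.{u} → Prop} :
    (∃ z ∈ famCode ι G, P z) ↔ ∃ f ∈ G, P (funCode ι f) := by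
  simp [mem_famCode]

theorem exists_dual_apply_eq [Nontrivial X] (r : ℝ) : ∃ (f : StrongDual ℝ X) (x : X), f x = r := by
  obtain ⟨x, hx⟩ := exists_ne (0 : X)
  obtain ⟨f, -, hf⟩ := exists_dual_vector ℝ x (norm_ne_zero_iff.2 hx)
  refine ⟨f, (r / ‖x‖) • x, ?_⟩
  have : ‖x‖ ≠ 0 := norm_ne_zero_iff.2 hx
  simp [hf, this]

/-- As X ≠ 0, functionals take arbitrarily large values, so every fraction lies in some value. This
defines the fractions from X* without arithmetic. -/
theorem mem_fracSet [Nontrivial X] {t : ZFSet.{u}} : t ∈ fracSet.{u} ↔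
    ∃ f ∈ famCode ι Set.univ, ∃ x ∈ carrierCode ι, ValMem t f x := by
  simp only [exists_mem_famCode, ← subCode_univ, exists_mem_subCode, Set.mem_univ, true_and,
    valMem_funCode]
  constructor
  · intro h
    obtain ⟨s, rfl⟩ := ZFSet.mem_range.1 h
    obtain ⟨f, x, hfx⟩ := exists_dual_apply_eq (X := X) (fracVal s + 1)
    exact ⟨f, x, fracCode_mem_realCode.2 (by linarith)⟩
  · rintro ⟨f, x, h⟩
    obtain ⟨s, -, rfl⟩ := mem_realCode.1 h
    exact fracCode_mem_fracSet s

end Codes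

/-! ### Objects that belong to M once X* does. -/

section Submodel

variable {X : Type u} [NormedAddCommGroup X] [NormedSpace ℝ X] (ι : X ↪ ZFSet.{u})
  {θ : Cardinal.{u}}

/-- `H(θ)` contains all sets of points of `X`, all functionals and all fractions. -/
structure LargeFor (θ : Cardinal.{u}) : Prop where
  powerset : (carrierCode ι).powerset.powerset ∈ hSet θ
  dual : famCode ι Set.univ ∈ hSet θ
  frac : fracSet.{u} ∈ hSet θ

theorem exists_largeFor : ∃ θ₀ : Cardinal.{u}, ∀ θ, θ₀ < θ → LargeFor ι θ := by
  obtain ⟨a, ha⟩ := exists_forall_mem_hSet (carrierCode ι).powerset.powerset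
  obtain ⟨b, hb⟩ := exists_forall_mem_hSet (famCode ι Set.univ)
  obtain ⟨c, hc⟩ := exists_forall_mem_hSet fracSet.{u}
  exact ⟨max a (max b c), fun θ h =>
    ⟨ha θ ((le_max_left _ _).trans_lt h),
      hb θ (((le_max_left _ _).trans (le_max_right _ _)).trans_lt h),
      hc θ (((le_max_right _ _).trans (le_max_right _ _)).trans_lt h)⟩⟩

variable {ι}

namespace LargeFor

theorem carrier (h : LargeFor ι θ) : carrierCode ι ∈ hSet θ :=
  hSet_transitive (hSet_transitive h.powerset (y := (carrierCode ι).powerset) (by simp)) (by simp)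

theorem sub (h : LargeFor ι θ) (S : Set X) : subCode ι S ∈ hSet θ :=
  hSet_of_subset h.carrier (subCode_univ (ι := ι) ▸ subCode_subset.2 (Set.subset_univ S))

theorem fam (h : LargeFor ι θ) (G : Set (StrongDual ℝ X)) : famCode ι G ∈ hSet θ :=
  hSet_of_subset h.dual fun z hz => by
    obtain ⟨f, -, rfl⟩ := mem_famCode.1 hz
    exact coe_mem_famCode.2 (Set.mem_univ f)

theorem point (h : LargeFor ι θ) (x : X) : ι x ∈ hSet θ :=
  hSet_transitive h.carrier (coe_mem_carrierCode x)

theorem functional (h : LargeFor ι θ) (f : StrongDual ℝ X) : funCode ι f ∈ hSet θ :=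
  hSet_transitive h.dual (coe_mem_famCode.2 (Set.mem_univ f))

end LargeFor

variable {M : ElemSub θ}

theorem natCode_mem_sets (hL : LargeFor ι θ) (n : ℕ) : natCode n ∈ M.sets := by
  have hH : ∀ n, natCode n ∈ hSet θ := fun n =>
    (hSet_of_pair (hSet_transitive hL.frac (fracCode_mem_fracSet (n, 0, 0)))).1
  induction n with
  | zero =>
    refine M.mem_sets_of_def (Q := fun z => z ≠ z) (hH 0)
      (DefM.eqVal (IsTerm.var none) (IsTerm.var none)).not ?_
    simp [natCode]
  | succ n ih =>
    obtain ⟨m, hm, hmn⟩ := ih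
    refine M.mem_sets_of_def (Q := fun z => z = m ∨ z ∈ (m : ZFSet)) (hH (n + 1))
      ((DefM.eqVal (IsTerm.var none) (IsTerm.const hm)).or
        (DefM.mem (IsTerm.var none) (IsTerm.const hm))) ?_
    simp [natCode, hmn]

theorem fracCode_mem_sets (hL : LargeFor ι θ) (t : ℕ × ℕ × ℕ) : fracCode t ∈ M.sets := by
  have h := hSet_transitive hL.frac (fracCode_mem_fracSet t)
  exact M.pair_mem_sets h (natCode_mem_sets hL _)
    (M.pair_mem_sets (hSet_of_pair h).2 (natCode_mem_sets hL _) (natCode_mem_sets hL _))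

/-- X is the common domain of the functionals, hence definable from X*. -/
theorem carrierCode_mem_sets (hL : LargeFor ι θ) (hD : famCode ι Set.univ ∈ M.sets) :
    carrierCode ι ∈ M.sets := by
  obtain ⟨d, hd, hdv⟩ := hD
  refine M.mem_sets_of_def (Q := fun x => ∃ f ∈ (d : ZFSet), ∃ r ∈ hSet θ, ZFSet.pair x r ∈ f)
    hL.carrier (by
      apply_rules [DefM.bex, DefM.exH, DefM.pairMem, IsTerm.const, IsTerm.var]) fun x hx => ?_
  constructor
  · intro h
    obtain ⟨x, rfl⟩ := mem_carrierCode.1 h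
    refine ⟨funCode ι 0, hdv ▸ coe_mem_famCode.2 (Set.mem_univ _), realCode 0, ?_,
      pair_mem_funCode.2 rfl⟩
    exact (hSet_of_pair (hSet_transitive (hL.functional 0)
      (pair_mem_funCode (f := 0) (x := x).2 rfl))).2
  · rintro ⟨f, hf, r, -, h⟩
    rw [hdv] at hf
    obtain ⟨f, -, rfl⟩ := mem_famCode.1 hf
    simp only [funCode, ZFSet.mem_range, ZFSet.pair_inj] at h
    obtain ⟨y, rfl, -⟩ := h
    exact coe_mem_carrierCode y

theorem fracSet_mem_sets [Nontrivial X] (hL : LargeFor ι θ) (hD : famCode ι Set.univ ∈ M.sets) :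
    fracSet.{u} ∈ M.sets := by
  obtain ⟨c, hc, hcv⟩ := carrierCode_mem_sets hL hD
  obtain ⟨d, hd, hdv⟩ := hD
  refine M.mem_sets_of_def (Q := fun t => ∃ f ∈ (d : ZFSet), ∃ x ∈ (c : ZFSet), ValMem t f x)
    hL.frac (by
      apply_rules [DefM.bex, DefM.valMem, IsTerm.const, IsTerm.var]) fun t _ => ?_
  rw [hcv, hdv]
  exact mem_fracSet

theorem subCode_mem_sets_of_def (hL : LargeFor ι θ) {c : hSet θ} (hc : c ∈ M)
    (hcv : (c : ZFSet) = carrierCode ι) {Q : ZFSet.{u} → Prop}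
    (hQ : DefM M fun v : Option Unit → hSet θ => Q (v none)) :
    subCode ι {x | Q (ι x)} ∈ M.sets := by
  refine M.mem_sets_of_def (Q := fun z => z ∈ (c : ZFSet) ∧ Q z) (hL.sub _)
    ((DefM.mem (IsTerm.var none) (IsTerm.const hc)).and hQ) fun z _ => ?_
  rw [hcv, mem_subCode, mem_carrierCode]
  exact ⟨fun ⟨x, h, e⟩ => ⟨⟨x, e⟩, e ▸ h⟩, fun ⟨⟨x, e⟩, h⟩ => ⟨x, by subst e; exact h, e⟩⟩

theorem subCode_inter_mem_sets (hL : LargeFor ι θ) {S T : Set X} (hS : subCode ι S ∈ M.sets)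
    (hT : subCode ι T ∈ M.sets) : subCode ι (S ∩ T) ∈ M.sets := by
  obtain ⟨s, hs, hsv⟩ := hS
  obtain ⟨t, ht, htv⟩ := hT
  refine M.mem_sets_of_def (Q := fun z => z ∈ (s : ZFSet) ∧ z ∈ (t : ZFSet)) (hL.sub _)
    ((DefM.mem (IsTerm.var none) (IsTerm.const hs)).and
      (DefM.mem (IsTerm.var none) (IsTerm.const ht))) fun z _ => ?_
  rw [hsv, htv, mem_subCode, mem_subCode, mem_subCode]
  constructor
  · rintro ⟨x, ⟨h1, h2⟩, rfl⟩
    exact ⟨⟨x, h1, rfl⟩, ⟨x, h2, rfl⟩⟩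
  · rintro ⟨⟨x, h1, rfl⟩, ⟨y, h2, h⟩⟩
    rw [ι.injective h] at h2
    exact ⟨x, ⟨h1, h2⟩, rfl⟩

theorem subCode_biInter_mem_sets (hL : LargeFor ι θ) (hD : famCode ι Set.univ ∈ M.sets)
    {β : Type*} (s : Finset β) {S : β → Set X} (hS : ∀ i ∈ s, subCode ι (S i) ∈ M.sets) :
    subCode ι (⋂ i ∈ s, S i) ∈ M.sets := by
  classical
  induction s using Finset.induction_on with
  | empty => simpa [subCode_univ] using carrierCode_mem_sets hL hD
  | insert a s _ ih =>
    rw [Finset.set_biInter_insert]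
    exact subCode_inter_mem_sets hL (hS a (Finset.mem_insert_self a s))
      (ih fun i hi => hS i (Finset.mem_insert_of_mem hi))

theorem exists_mem_of_subCode (hL : LargeFor ι θ) {S : Set X} (hS : subCode ι S ∈ M.sets)
    (hne : S.Nonempty) : ∃ x ∈ S, ι x ∈ M.sets := by
  obtain ⟨x, hx⟩ := hne
  obtain ⟨s, hs, hsv⟩ := hS
  obtain ⟨y, hy, hys⟩ := M.exists_mem_sets (P := fun y => y ∈ (s : ZFSet))
    (DefM.mem (IsTerm.var ()) (IsTerm.const hs)) (hL.point x) (hsv ▸ coe_mem_subCode.2 hx)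
  obtain ⟨z, hz, rfl⟩ := mem_subCode.1 (hsv ▸ hys)
  exact ⟨z, hz, hy⟩

/-- Points of a set `S ∈ M` can be approximated at finitely many functionals in `M` by points of
`S ∩ M`. -/
theorem exists_approx (hL : LargeFor ι θ) (hD : famCode ι Set.univ ∈ M.sets) {K : Set X}
    (hK : subCode ι K ∈ M.sets) {p : X} (hp : p ∈ K) (G : Finset (StrongDual ℝ X))
    (hG : ∀ g ∈ G, funCode ι g ∈ M.sets) {ε : ℝ} (hε : 0 < ε) :
    ∃ q ∈ K, ι q ∈ M.sets ∧ ∀ g ∈ G, |g q - g p| < ε := by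
  obtain ⟨c, hc, hcv⟩ := carrierCode_mem_sets hL hD
  have hlo : ∀ g : StrongDual ℝ X, ∃ t, g p - ε < fracVal t ∧ fracVal t < g p := fun g =>
    exists_fracVal_between (by linarith)
  have hup : ∀ g : StrongDual ℝ X, ∃ t, g p < fracVal t ∧ fracVal t < g p + ε := fun g =>
    exists_fracVal_between (by linarith)
  choose lo hlo1 hlo2 using hlo
  choose up hup1 hup2 using hup
  -- Each condition confines g q between two fractions within ε of g p. The finite intersection with
  -- K lies in M and contains p, so it has a point in M although p need not be one.
  obtain ⟨q, ⟨hqK, hq⟩, hqM⟩ := exists_mem_of_subCode hL (subCode_inter_mem_sets hL hK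
    (subCode_biInter_mem_sets hL hD G
      (S := fun g => {q | fracVal (lo g) < g q ∧ ¬ fracVal (up g) < g q}) fun g hg => by
        obtain ⟨g', hg', hgv⟩ := hG g hg
        obtain ⟨l, hl, hlv⟩ := fracCode_mem_sets (M := M) hL (lo g)
        obtain ⟨w, hw, hwv⟩ := fracCode_mem_sets (M := M) hL (up g)
        have := subCode_mem_sets_of_def hL hc hcv
          (Q := fun q => ValMem l g' q ∧ ¬ ValMem w g' q)
          (by apply_rules [DefM.and, DefM.not, DefM.valMem, IsTerm.const, IsTerm.var])
        simpa only [hgv, hlv, hwv, valMem_fracCode] using this))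
    ⟨p, hp, by
      simp only [Set.mem_iInter]
      exact fun g _ => ⟨hlo2 g, (hup1 g).not_gt⟩⟩
  refine ⟨q, hqK, hqM, fun g hg => ?_⟩
  simp only [Set.mem_iInter] at hq
  have h1 := (hq g hg).1
  have h2 := not_lt.1 (hq g hg).2
  rw [abs_lt]
  constructor
  · linarith [hlo1 g]
  · linarith [hup2 g]

/-- A fraction between a and f x serves as a parameter from M, so the real a need not belong to M.
-/
theorem exists_norming_mem (hL : LargeFor ι θ) {B : Set (StrongDual ℝ X)}
    (hB : famCode ι B ∈ M.sets) {x : X} (hx : ι x ∈ M.sets) {a : ℝ} {f : StrongDual ℝ X}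
    (hf : f ∈ B) (ha : a < f x) : ∃ g ∈ B, funCode ι g ∈ M.sets ∧ a < g x := by
  obtain ⟨t, h1, h2⟩ := exists_fracVal_between ha
  obtain ⟨b, hb, hbv⟩ := hB
  obtain ⟨x', hx', hxv⟩ := hx
  obtain ⟨s, hs, hsv⟩ := fracCode_mem_sets (M := M) hL t
  obtain ⟨g, hg, hgb, hgx⟩ := M.exists_mem_sets (P := fun g => g ∈ (b : ZFSet) ∧ ValMem s g x')
    (by apply_rules [DefM.and, DefM.mem, DefM.valMem, IsTerm.const, IsTerm.var])
    (hL.functional f)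
    ⟨by rw [hbv]; exact coe_mem_famCode.2 hf, by rw [hsv, hxv]; exact valMem_fracCode.2 h2⟩
  rw [hbv] at hgb
  obtain ⟨g, hgB, rfl⟩ := mem_famCode.1 hgb
  rw [hsv, hxv, valMem_fracCode] at hgx
  exact ⟨g, hgB, hg, h1.trans hgx⟩

end Submodel

/-! ### X_M is a linear subspace. -/

section Subspace

variable {X : Type u} [NormedAddCommGroup X] [NormedSpace ℝ X] {ι : X ↪ ZFSet.{u}}
  {θ : Cardinal.{u}} {M : ElemSub θ}

theorem exists_submodule_eq_closure {A : Set X} (hA : A.Nonempty)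
    (h : ∀ x ∈ A, ∀ y ∈ A, ∀ c : ℝ, x + c • y ∈ closure A) :
    ∃ Y : Submodule ℝ X, (Y : Set X) = closure A := by
  have h' : ∀ x ∈ closure A, ∀ y ∈ closure A, ∀ c : ℝ, x + c • y ∈ closure A := by
    intro x hx y hy c
    have := map_mem_closure₂ (f := fun x y : X => x + c • y) (by fun_prop) hx hy
      (u := closure A) (fun x hx y hy => h x hx y hy c)
    rwa [closure_closure] at this
  obtain ⟨a, ha⟩ := hA
  refine ⟨{ carrier := closure A, add_mem' := ?_, zero_mem' := ?_, smul_mem' := ?_ }, rfl⟩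
  · intro x y hx hy
    simpa using h' x hx y hy 1
  · simpa using h' a (subset_closure ha) a (subset_closure ha) (-1)
  · intro c y hy
    have := h' y hy y hy (c - 1)
    rwa [sub_smul, one_smul, add_sub_cancel] at this

/-- A norming, bounded set `B ∈ M` of functionals makes `cl (X ∩ M)` a linear subspace. -/
theorem add_smul_mem_closure (hL : LargeFor ι θ) (hD : famCode ι Set.univ ∈ M.sets)
    {B : Set (StrongDual ℝ X)} (hB : famCode ι B ∈ M.sets) {b c₀ : ℝ} (hb : ∀ f ∈ B, ‖f‖ ≤ b)
    (hc₀ : 0 ≤ c₀) (hn : ∀ x : X, ∀ ε > 0, ∃ f ∈ B, ‖x‖ ≤ c₀ * f x + ε)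
    {x y : X} (hx : ι x ∈ M.sets) (hy : ι y ∈ M.sets) (c : ℝ) :
    x + c • y ∈ inducedSubspace ι M := by
  refine Metric.mem_closure_iff.2 fun ε₀ hε₀ => ?_
  obtain ⟨ε, hε, hεc⟩ : ∃ ε > 0, c₀ * ε < ε₀ := by
    refine ⟨ε₀ / (2 * (c₀ + 1)), by positivity, ?_⟩
    rw [mul_div_assoc', div_lt_iff₀ (by positivity)]
    nlinarith
  -- If f x and f y are known up to δ, then f (x + c • y) is known up to ε / 4.
  obtain ⟨δ, hδ, hδε⟩ : ∃ δ > 0, (1 + |c|) * δ ≤ ε / 4 := by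
    refine ⟨ε / 4 / (1 + |c|), by positivity, ?_⟩
    rw [mul_div_cancel₀ _ (by positivity)]
  -- A compact rectangle containing (f x, f y) for all f ∈ B; finitely many boxes with fraction
  -- corners will cover it.
  set T : Set (ℝ × ℝ) :=
    Set.Icc (-(b * ‖x‖)) (b * ‖x‖) ×ˢ Set.Icc (-(b * ‖y‖)) (b * ‖y‖)
  have hT : IsCompact T := isCompact_Icc.prod isCompact_Icc
  have hfr : ∀ r s : ℝ, ∃ t, r < s → r < fracVal t ∧ fracVal t < s := fun r s => by
    by_cases h : r < s
    · obtain ⟨t, ht⟩ := exists_fracVal_between h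
      exact ⟨t, fun _ => ht⟩
    · exact ⟨0, fun h' => absurd h' h⟩
  choose fr hfr using hfr
  let lo : ℝ → ℕ × ℕ × ℕ := fun s => fr (s - δ) s
  let up : ℝ → ℕ × ℕ × ℕ := fun s => fr s (s + δ)
  have hlo : ∀ s, s - δ < fracVal (lo s) ∧ fracVal (lo s) < s := fun s => hfr _ _ (by linarith)
  have hup : ∀ s, s < fracVal (up s) ∧ fracVal (up s) < s + δ := fun s => hfr _ _ (by linarith)
  -- The window from `p s` to `q s` contains all values within ε / 4 of s, in particular those of x
  -- + c • y, and only values within ε / 2 of s.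
  let p : ℝ → ℕ × ℕ × ℕ := fun s => fr (s - ε / 2) (s - ε / 4)
  let q : ℝ → ℕ × ℕ × ℕ := fun s => fr (s + ε / 4) (s + ε / 2)
  have hp : ∀ s, s - ε / 2 < fracVal (p s) ∧ fracVal (p s) < s - ε / 4 := fun s =>
    hfr _ _ (by linarith)
  have hq : ∀ s, s + ε / 4 < fracVal (q s) ∧ fracVal (q s) < s + ε / 2 := fun s =>
    hfr _ _ (by linarith)
  obtain ⟨F, -, hF⟩ := hT.elim_nhds_subcover
    (fun s => Set.Ioo (fracVal (lo s.1)) (fracVal (up s.1)) ×ˢ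
      Set.Ioo (fracVal (lo s.2)) (fracVal (up s.2)))
    fun s _ => prod_mem_nhds (Ioo_mem_nhds (hlo _).2 (hup _).1) (Ioo_mem_nhds (hlo _).2 (hup _).1)
  let val : ℝ × ℝ → ℝ := fun s => s.1 + c * s.2
  -- Points z on which every f ∈ B with (f x, f y) in box s behaves approximately as on x + c • y.
  -- Only fractions, x, y and B occur as parameters, so c need not lie in M.
  let S : ℝ × ℝ → Set X := fun s => {z | ∀ f ∈ B,
    (fracVal (lo s.1) < f x ∧ ¬ fracVal (up s.1) < f x ∧
      fracVal (lo s.2) < f y ∧ ¬ fracVal (up s.2) < f y) →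
    fracVal (p (val s)) < f z ∧ ¬ fracVal (q (val s)) < f z}
  have hS : ∀ s, subCode ι (S s) ∈ M.sets := by
    intro s
    obtain ⟨k, hk, hkv⟩ := carrierCode_mem_sets hL hD
    obtain ⟨β, hβ, hβv⟩ := hB
    obtain ⟨x', hx', hxv⟩ := hx
    obtain ⟨y', hy', hyv⟩ := hy
    obtain ⟨l1, hl1, hl1v⟩ := fracCode_mem_sets (M := M) hL (lo s.1)
    obtain ⟨u1, hu1, hu1v⟩ := fracCode_mem_sets (M := M) hL (up s.1)
    obtain ⟨l2, hl2, hl2v⟩ := fracCode_mem_sets (M := M) hL (lo s.2)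
    obtain ⟨u2, hu2, hu2v⟩ := fracCode_mem_sets (M := M) hL (up s.2)
    obtain ⟨p', hp', hpv⟩ := fracCode_mem_sets (M := M) hL (p (val s))
    obtain ⟨q', hq', hqv⟩ := fracCode_mem_sets (M := M) hL (q (val s))
    have := subCode_mem_sets_of_def hL hk hkv
      (Q := fun z => ∀ f ∈ (β : ZFSet), (ValMem l1 f x' ∧ ¬ ValMem u1 f x' ∧
        ValMem l2 f y' ∧ ¬ ValMem u2 f y') → ValMem p' f z ∧ ¬ ValMem q' f z)
      (by apply_rules [DefM.ball, DefM.and, DefM.not, DefM.imp, DefM.valMem, IsTerm.const,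
        IsTerm.var])
    simpa only [hβv, hxv, hyv, hl1v, hu1v, hl2v, hu2v, hpv, hqv, forall_mem_famCode,
      valMem_fracCode] using this
  have hbox : ∀ s f, (fracVal (lo s.1) < f x ∧ ¬ fracVal (up s.1) < f x ∧
      fracVal (lo s.2) < f y ∧ ¬ fracVal (up s.2) < f y) →
      |(f : StrongDual ℝ X) (x + c • y) - val s| ≤ ε / 4 := by
    rintro s f ⟨h1, h2, h3, h4⟩
    have e1 : |f x - s.1| ≤ δ := by
      rw [abs_le]
      constructor <;> linarith [(hlo s.1).1, (hup s.1).2]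
    have e2 : |f y - s.2| ≤ δ := by
      rw [abs_le]
      constructor <;> linarith [(hlo s.2).1, (hup s.2).2]
    have e3 : f (x + c • y) - val s = (f x - s.1) + c * (f y - s.2) := by
      simp only [map_add, map_smul, smul_eq_mul, val]; ring
    rw [e3]
    calc _ ≤ |f x - s.1| + |c| * |f y - s.2| := (abs_add_le _ _).trans (by rw [abs_mul])
      _ ≤ δ + |c| * δ := by gcongr
      _ ≤ ε / 4 := by linarith
  obtain ⟨z, hz, hzM⟩ := exists_mem_of_subCode hL
    (subCode_biInter_mem_sets hL hD F fun s _ => hS s) ⟨x + c • y, by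
      simp only [Set.mem_iInter]
      intro s _ f _ h
      have := abs_le.1 (hbox s f h)
      exact ⟨by linarith [(hp (val s)).2], by linarith [(hq (val s)).1]⟩⟩
  refine ⟨z, hzM, ?_⟩
  have hfz : ∀ f ∈ B, f (x + c • y - z) ≤ ε := by
    intro f hf
    have hfT : (f x, f y) ∈ T := by
      have hbd : ∀ w : X, f w ∈ Set.Icc (-(b * ‖w‖)) (b * ‖w‖) := fun w =>
        abs_le.1 ((f.le_opNorm w).trans (by gcongr; exact hb f hf))
      exact ⟨hbd x, hbd y⟩
    obtain ⟨s, hs, h1, h2⟩ := Set.mem_iUnion₂.1 (hF hfT)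
    have hbx : fracVal (lo s.1) < f x ∧ ¬ fracVal (up s.1) < f x ∧
        fracVal (lo s.2) < f y ∧ ¬ fracVal (up s.2) < f y :=
      ⟨h1.1, h1.2.not_gt, h2.1, h2.2.not_gt⟩
    have h3 := (Set.mem_iInter₂.1 hz s hs f hf hbx).1
    have h4 := (abs_le.1 (hbox s f hbx)).2
    rw [map_sub]
    linarith [(hp (val s)).1]
  rw [dist_eq_norm]
  by_contra! hlt
  obtain ⟨f, hf, h⟩ := hn (x + c • y - z) ((ε₀ - c₀ * ε) / 2) (by linarith)
  nlinarith [mul_le_mul_of_nonneg_left (hfz f hf) hc₀]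

end Subspace

/-! ### Weak compactness expressed in H(θ). -/

section WeakCompact

variable {X : Type u} [NormedAddCommGroup X] [NormedSpace ℝ X] {ι : X ↪ ZFSet.{u}}
  {θ : Cardinal.{u}} {M : ElemSub θ}

/-- `U` is a base of an ultrafilter on the set `K`. -/
def IsUltraBase (θ : Cardinal.{u}) (K U : ZFSet.{u}) : Prop :=
  (∀ V ∈ U, V ⊆ K) ∧ (∀ V ∈ U, ∃ x ∈ V, x ∈ K) ∧
    (∀ V ∈ U, ∀ W ∈ U, ∃ V' ∈ U, V' ⊆ V ∧ V' ⊆ W) ∧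
    ∀ S ∈ hSet θ, S ⊆ K → S ∈ U ∨ ∃ V ∈ U, ∀ x ∈ V, ¬ x ∈ S

/-- Weak compactness of `K` with respect to the family `D` of functionals, expressed in `H(θ)`:
ultrafilters on `K` converge. -/
def IsWeakCompactCode (θ : Cardinal.{u}) (D T K : ZFSet.{u}) : Prop :=
  ∀ U ∈ hSet θ, IsUltraBase θ K U →
    ∃ x ∈ K, ∀ f ∈ D, ∀ t ∈ T, ValMem t f x → ∃ V ∈ U, ∀ y ∈ V, ValMem t f y

/-- The filter generated by U clusters at some x ∈ K. If t < f x, then U decides the set of y ∈ K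
with t < f y, and a member of U missing it would contradict clustering at x. -/
theorem IsWeakCompactCode.of_isCompact (hL : LargeFor ι θ) {K : Set X}
    (hK : IsCompact (toWeakSpace ℝ X '' K)) :
    IsWeakCompactCode θ (famCode ι Set.univ) fracSet.{u} (subCode ι K) := by
  rintro U - ⟨hUK, hUne, hUdir, hU⟩
  let pts : ZFSet.{u} → Set (WeakSpace ℝ X) := fun V => toWeakSpace ℝ X '' {x | ι x ∈ V}
  have hKU : subCode ι K ∈ U ∨ ∃ V ∈ U, ∀ x ∈ V, ¬ x ∈ subCode ι K :=
    hU _ (hL.sub K) fun _ h => h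
  have hne : Nonempty {V // V ∈ U} := by
    rcases hKU with h | ⟨V, h, -⟩
    exacts [⟨_, h⟩, ⟨V, h⟩]
  let l : Filter (WeakSpace ℝ X) := ⨅ V : {V // V ∈ U}, Filter.principal (pts V.1)
  have hmem : ∀ V ∈ U, pts V ∈ l := fun V hV =>
    Filter.mem_iInf_of_mem (⟨V, hV⟩ : {V // V ∈ U}) (Filter.mem_principal_self _)
  have hl : l.NeBot := by
    refine Filter.iInf_neBot_of_directed' ?_ ?_
    · rintro ⟨V, hV⟩ ⟨W, hW⟩
      obtain ⟨V', hV', h1, h2⟩ := hUdir V hV W hW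
      refine ⟨⟨V', hV'⟩, Filter.principal_mono.2 ?_, Filter.principal_mono.2 ?_⟩
      · exact Set.image_mono fun x hx => h1 hx
      · exact Set.image_mono fun x hx => h2 hx
    · rintro ⟨V, hV⟩
      obtain ⟨x, hx, hxK⟩ := hUne V hV
      obtain ⟨x, -, rfl⟩ := mem_subCode.1 hxK
      exact Filter.principal_neBot_iff.2 ⟨_, x, hx, rfl⟩
  have hlK : l ≤ Filter.principal (toWeakSpace ℝ X '' K) := by
    obtain ⟨V, hV⟩ := hne
    refine Filter.le_principal_iff.2 (Filter.mem_of_superset (hmem V hV) ?_)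
    exact Set.image_mono fun x hx => coe_mem_subCode.1 (hUK V hV hx)
  obtain ⟨_, ⟨x, hx, rfl⟩, hcl⟩ := hK hlK
  refine ⟨ι x, coe_mem_subCode.2 hx, forall_mem_famCode.2 fun f _ t ht hfx => ?_⟩
  obtain ⟨t, rfl⟩ := ZFSet.mem_range.1 ht
  rw [valMem_fracCode] at hfx
  rcases hU (subCode ι {y | y ∈ K ∧ fracVal t < f y}) (hL.sub _)
    (subCode_subset.2 fun y hy => hy.1) with h | ⟨V, hV, h⟩
  · exact ⟨_, h, forall_mem_subCode.2 fun y hy => valMem_fracCode.2 hy.2⟩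
  · exfalso
    have hnh : {w | fracVal t < f ((toWeakSpace ℝ X).symm w)} ∈ nhds (toWeakSpace ℝ X x) :=
      (isOpen_lt continuous_const (continuous_weakSpace_apply f)).mem_nhds (by simpa using hfx)
    obtain ⟨_, h1, y, hy, rfl⟩ := clusterPt_iff_nonempty.1 hcl hnh (hmem V hV)
    exact h _ hy (coe_mem_subCode.2 ⟨coe_mem_subCode.1 (hUK V hV hy), by simpa using h1⟩)

/-- The subsets of K in a given ultrafilter form an ultrafilter base that is itself an element of
H(θ). Lower bounds alone are coded; upper bounds come from -f. -/
theorem IsWeakCompactCode.isCompact (hL : LargeFor ι θ) {K : Set X}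
    (hK : IsWeakCompactCode θ (famCode ι Set.univ) fracSet.{u} (subCode ι K)) :
    IsCompact (toWeakSpace ℝ X '' K) := by
  refine isCompact_iff_ultrafilter_le_nhds.2 fun 𝓤 h𝓤 => ?_
  have hK𝓤 : toWeakSpace ℝ X '' K ∈ 𝓤 := Filter.le_principal_iff.1 h𝓤
  let U : ZFSet.{u} := ZFSet.range
    fun S : {S : Set X // S ⊆ K ∧ toWeakSpace ℝ X '' S ∈ 𝓤} => subCode ι S.1
  have hU : ∀ {z}, z ∈ U ↔ ∃ S ⊆ K, toWeakSpace ℝ X '' S ∈ 𝓤 ∧ subCode ι S = z := by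
    intro z
    simp only [U, ZFSet.mem_range, Subtype.exists, exists_prop, and_assoc]
  have hUH : U ∈ hSet θ := by
    refine hSet_of_subset (hSet_transitive hL.powerset
      (y := (carrierCode ι).powerset) (by simp)) fun z hz => ?_
    obtain ⟨S, -, -, rfl⟩ := hU.1 hz
    rw [ZFSet.mem_powerset, ← subCode_univ]
    exact subCode_subset.2 (Set.subset_univ S)
  obtain ⟨x, hx, hconv⟩ := hK U hUH (by
    refine ⟨?_, ?_, ?_, ?_⟩
    · intro V hV
      obtain ⟨S, hS, -, rfl⟩ := hU.1 hV
      exact subCode_subset.2 hS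
    · intro V hV
      obtain ⟨S, hS, hSU, rfl⟩ := hU.1 hV
      obtain ⟨x, hx⟩ := Set.image_nonempty.1 (Ultrafilter.nonempty_of_mem hSU)
      exact ⟨ι x, coe_mem_subCode.2 hx, coe_mem_subCode.2 (hS hx)⟩
    · intro V hV W hW
      obtain ⟨S, hS, hSU, rfl⟩ := hU.1 hV
      obtain ⟨S', hS', hSU', rfl⟩ := hU.1 hW
      refine ⟨subCode ι (S ∩ S'), hU.2 ⟨_, Set.inter_subset_left.trans hS, ?_, rfl⟩,
        subCode_subset.2 Set.inter_subset_left, subCode_subset.2 Set.inter_subset_right⟩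
      rw [Set.image_inter (toWeakSpace ℝ X).injective]
      exact Filter.inter_mem hSU hSU'
    · intro S _ hSK
      have hSc : S ⊆ carrierCode ι := fun z hz =>
        subCode_univ (ι := ι) ▸ subCode_subset.2 (Set.subset_univ K) (hSK hz)
      obtain ⟨S', hSv⟩ : ∃ S', S = subCode ι S' := ⟨_, eq_subCode hSc⟩
      subst hSv
      rw [subCode_subset] at hSK
      by_cases h : toWeakSpace ℝ X '' S' ∈ 𝓤
      · exact .inl (hU.2 ⟨S', hSK, h, rfl⟩)
      · refine .inr ⟨subCode ι (K \ S'), hU.2 ⟨_, Set.sdiff_subset, ?_, rfl⟩,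
          forall_mem_subCode.2 fun x hx h => hx.2 (coe_mem_subCode.1 h)⟩
        rw [Set.image_sdiff (toWeakSpace ℝ X).injective]
        exact Filter.inter_mem hK𝓤 (Ultrafilter.compl_mem_iff_notMem.2 h))
  obtain ⟨x, hxK, rfl⟩ := mem_subCode.1 hx
  refine ⟨_, ⟨x, hxK, rfl⟩, ?_⟩
  have key : ∀ (f : StrongDual ℝ X) (a : ℝ), a < f x →
      ∀ᶠ w in (𝓤 : Filter (WeakSpace ℝ X)), a < f ((toWeakSpace ℝ X).symm w) := by
    intro f a ha
    obtain ⟨t, h1, h2⟩ := exists_fracVal_between ha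
    obtain ⟨V, hV, h⟩ := hconv (funCode ι f) (coe_mem_famCode.2 (Set.mem_univ f)) (fracCode t)
      (fracCode_mem_fracSet t) (valMem_fracCode.2 h2)
    obtain ⟨S, hS, hSU, rfl⟩ := hU.1 hV
    refine Filter.mem_of_superset hSU ?_
    rintro _ ⟨y, hy, rfl⟩
    have := valMem_fracCode.1 (forall_mem_subCode.1 h y hy)
    simpa using h1.trans this
  have hinj : Function.Injective (topDualPairing ℝ X).flip := by
    intro x y hxy
    exact (toWeakSpace ℝ X).symm.injective
      ((SeparatingDual.eq_iff_forall_dual_eq (R := ℝ)).2 fun f => LinearMap.congr_fun hxy f)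
  refine (WeakBilin.tendsto_iff_forall_eval_tendsto (topDualPairing ℝ X).flip hinj
    (f := id)).2 fun f => tendsto_order.2 ⟨fun a ha => key f a ha, fun a ha => ?_⟩
  filter_upwards [key (-f) (-a) (neg_lt_neg ha)] with w hw
  exact neg_lt_neg_iff.1 hw

end WeakCompact

/-! ### The decomposition when only X* is known to be in M. -/

section Decomposition

variable {X : Type u} [NormedAddCommGroup X] [NormedSpace ℝ X] {ι : X ↪ ZFSet.{u}}
  {θ : Cardinal.{u}} {M : ElemSub θ}

theorem dense_span_of_separating {K : Set X}
    (h : ∀ f g : StrongDual ℝ X, (∀ x ∈ K, f x = g x) → f = g) :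
    Dense (Submodule.span ℝ K : Set X) := by
  intro x
  by_contra hx
  obtain ⟨f, u, hf, hu⟩ := geometric_hahn_banach_closed_point
    (Submodule.span ℝ K).convex.closure isClosed_closure hx
  have h0 : 0 < u := by
    simpa using hf 0 (subset_closure (Submodule.zero_mem _))
  have hf0 : f = 0 := by
    refine h f 0 fun y hy => ?_
    by_contra hne
    -- At this point of the span f takes the forbidden value u.
    have := hf ((u / f y) • y)
      (subset_closure (Submodule.smul_mem _ _ (Submodule.subset_span hy)))
    rw [map_smul, smul_eq_mul, div_mul_cancel₀ _ hne] at this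
    exact lt_irrefl _ this
  rw [hf0, _root_.zero_apply] at hu
  exact lt_asymm h0 hu

theorem DefM.isUltraBase : DefM M fun v : Option Unit → hSet θ =>
    IsUltraBase θ (v (some ())) (v none) := by
  unfold IsUltraBase
  apply_rules [DefM.subset, DefM.ball, DefM.bex, DefM.allH, DefM.and, DefM.or, DefM.not,
    DefM.imp, DefM.mem, IsTerm.var]

theorem DefM.isWeakCompactCode {d T : hSet θ} (hd : d ∈ M) (hT : T ∈ M) :
    DefM M fun v : Unit → hSet θ => IsWeakCompactCode θ d T (v ()) := by
  refine DefM.allH (DefM.isUltraBase.imp ?_)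
  apply_rules [DefM.ball, DefM.bex, DefM.imp, DefM.valMem, IsTerm.const, IsTerm.var]

/-- Some linearly dense weakly compact set belongs to `M`. -/
theorem exists_weakCompact_mem_sets [Nontrivial X] (hL : LargeFor ι θ)
    (hD : famCode ι Set.univ ∈ M.sets) (hX : IsWCG X) :
    ∃ K : Set X, subCode ι K ∈ M.sets ∧ IsCompact (toWeakSpace ℝ X '' K) ∧
      Dense (Submodule.span ℝ K : Set X) := by
  obtain ⟨c, hc, hcv⟩ := carrierCode_mem_sets hL hD
  obtain ⟨T, hT, hTv⟩ := fracSet_mem_sets hL hD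
  obtain ⟨d, hd, hdv⟩ := hD
  obtain ⟨K₀, hK₀, hK₀d⟩ := hX
  -- Linear density is stated as separation: functionals with the same cuts at every point of K are
  -- equal. No linear structure is needed as a parameter.
  obtain ⟨K, hK, hKc, hKs, hKw⟩ := M.exists_mem_sets
    (P := fun K => K ⊆ (c : ZFSet) ∧ (∀ f ∈ (d : ZFSet), ∀ g ∈ (d : ZFSet),
      (∀ x ∈ K, ∀ t ∈ (T : ZFSet), (ValMem t f x ↔ ValMem t g x)) → f = g) ∧
      IsWeakCompactCode θ d T K)
    (by
      apply_rules [DefM.subset, DefM.ball, DefM.and, DefM.iff, DefM.imp, DefM.valMem, DefM.eqVal,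
        DefM.isWeakCompactCode, IsTerm.const, IsTerm.var])
    (hL.sub K₀)
    ⟨by rw [hcv, ← subCode_univ]; exact subCode_subset.2 (Set.subset_univ _), by
      rw [hdv, hTv, forall_mem_famCode]
      refine fun f _ => forall_mem_famCode.2 fun g _ h => ?_
      rw [forall_mem_subCode] at h
      congr 1
      refine ContinuousLinearMap.ext_on hK₀d fun x hx => realCode_injective ?_
      ext t
      by_cases ht : t ∈ fracSet
      · simpa only [valMem_funCode] using h x hx t ht
      · have : ∀ r, t ∉ realCode r := fun r h => by
          obtain ⟨s, -, rfl⟩ := mem_realCode.1 h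
          exact ht (fracCode_mem_fracSet s)
        simp [this], by
      rw [hdv, hTv]
      exact IsWeakCompactCode.of_isCompact hL hK₀⟩
  rw [hcv] at hKc
  obtain ⟨K', rfl⟩ : ∃ K', K = subCode ι K' := ⟨_, eq_subCode hKc⟩
  rw [hdv, hTv] at hKw
  refine ⟨K', hK, hKw.isCompact hL, dense_span_of_separating fun f g h => ?_⟩
  refine funCode_injective (hKs (funCode ι f) (hdv ▸ coe_mem_famCode.2 (Set.mem_univ f))
    (funCode ι g) (hdv ▸ coe_mem_famCode.2 (Set.mem_univ g)) ?_)
  refine forall_mem_subCode.2 fun x hx t _ => ?_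
  rw [valMem_funCode, valMem_funCode, h x hx]

theorem norming_on_submodel (hL : LargeFor ι θ) {B : Set (StrongDual ℝ X)}
    (hB : famCode ι B ∈ M.sets) {b c : ℝ} (hb : ∀ f ∈ B, ‖f‖ ≤ b)
    (hc : 0 ≤ c) (hn : ∀ x : X, ∀ ε > 0, ∃ f ∈ B, ‖x‖ ≤ c * f x + ε)
    (x : X) (hx : ι x ∈ M.sets) (ε : ℝ) (hε : 0 < ε) :
    ∃ f ∈ famInter ι Set.univ M, ‖f‖ ≤ b ∧ ‖x‖ ≤ c * f x + ε := by
  obtain ⟨f, hf, hfx⟩ := hn x (ε / 2) (by positivity)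
  have hpos : 0 < ε / (2 * (c + 1)) := by positivity
  obtain ⟨g, hg, hgM, hgx⟩ := exists_norming_mem hL hB hx hf
    (a := f x - ε / (2 * (c + 1))) (by linarith)
  refine ⟨g, ⟨Set.mem_univ g, hgM⟩, hb g hg, ?_⟩
  have h1 : c * (ε / (2 * (c + 1))) ≤ ε / 2 := by
    rw [mul_div_assoc', div_le_iff₀ (by positivity)]
    nlinarith
  nlinarith [mul_le_mul_of_nonneg_left hgx.le hc]

theorem exists_isCompl_inducedSubspace [CompleteSpace X] [Nontrivial X] (hL : LargeFor ι θ)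
    (hD : famCode ι Set.univ ∈ M.sets) (hX : IsWCG X) {B : Set (StrongDual ℝ X)}
    (hB : famCode ι B ∈ M.sets) {b c : ℝ} (hb : ∀ f ∈ B, ‖f‖ ≤ b)
    (hc : 0 ≤ c) (hn : ∀ x : X, ∀ ε > 0, ∃ f ∈ B, ‖x‖ ≤ c * f x + ε) :
    ∃ Y : Submodule ℝ X, (Y : Set X) = inducedSubspace ι M ∧
      IsCompl Y (leftAnnihilator (famInter ι Set.univ M)) := by
  obtain ⟨K, hK, hKc, hKd⟩ := exists_weakCompact_mem_sets hL hD hX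
  obtain ⟨a, -, ha⟩ := exists_mem_of_subCode (S := Set.univ) hL
    (by rw [subCode_univ]; exact carrierCode_mem_sets hL hD) Set.univ_nonempty
  obtain ⟨Y, hY⟩ := exists_submodule_eq_closure (A := {x | ι x ∈ M.sets}) ⟨a, ha⟩
    fun x hx y hy r => add_smul_mem_closure hL hD hB hb hc hn hx hy r
  -- Any member of B shows that b is nonnegative.
  obtain ⟨f, hf, -⟩ := hn 0 1 one_pos
  refine ⟨Y, hY, isCompl_leftAnnihilator hKc hKd hY hc ((norm_nonneg f).trans (hb f hf))
    (norming_on_submodel hL hB hb hc hn) fun p hp G hG ε hε => ?_⟩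
  exact exists_approx hL hD hK hp G (fun g hg => (hG hg).2) hε

/-- M contains a point x of X and, if x = 0, another one distinct from it; this avoids defining the
zero vector. -/
theorem exists_ne_zero_mem_sets [Nontrivial X] (hL : LargeFor ι θ)
    (hD : famCode ι Set.univ ∈ M.sets) : ∃ x : X, ι x ∈ M.sets ∧ x ≠ 0 := by
  obtain ⟨c, hc, hcv⟩ := carrierCode_mem_sets hL hD
  obtain ⟨x₀, hx₀⟩ := exists_ne (0 : X)
  obtain ⟨_, hx, hxc, y, hyc, hxy⟩ := M.exists_mem_sets
    (P := fun x => x ∈ (c : ZFSet) ∧ ∃ y ∈ (c : ZFSet), ¬ x = y)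
    (by apply_rules [DefM.bex, DefM.and, DefM.not, DefM.mem, DefM.eqVal, IsTerm.const, IsTerm.var])
    (hL.point x₀) ⟨hcv ▸ coe_mem_carrierCode x₀, ι 0, hcv ▸ coe_mem_carrierCode 0,
      fun h => hx₀ (ι.injective h)⟩
  rw [hcv] at hxc
  obtain ⟨x, rfl⟩ := mem_carrierCode.1 hxc
  by_cases h0 : x = 0
  · obtain ⟨_, hy, hyc', hyx⟩ := M.exists_mem_sets
      (P := fun y => y ∈ (c : ZFSet) ∧ ¬ y = ((⟨ι x, M.mem_hSet hx⟩ : hSet θ) : ZFSet))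
      (by
        have := (M.mem_sets (x := ⟨ι x, M.mem_hSet hx⟩)).1 hx
        apply_rules [DefM.and, DefM.not, DefM.mem, DefM.eqVal, IsTerm.const, IsTerm.var])
      (hSet_transitive c.2 hyc) ⟨hyc, fun h => hxy h.symm⟩
    rw [hcv] at hyc'
    obtain ⟨y, rfl⟩ := mem_carrierCode.1 hyc'
    exact ⟨y, hy, fun h => hyx (congrArg ι (h.trans h0.symm))⟩
  · exact ⟨x, hx, h0⟩

/-- Some bounded norming set of functionals belongs to `M`. -/
theorem exists_norming_mem_sets [CompleteSpace X] [Nontrivial X] (hL : LargeFor ι θ)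
    (hD : famCode ι Set.univ ∈ M.sets) :
    ∃ (B : Set (StrongDual ℝ X)) (b c : ℝ), famCode ι B ∈ M.sets ∧ (∀ f ∈ B, ‖f‖ ≤ b) ∧ 0 ≤ c ∧
      ∀ x : X, ∀ ε > 0, ∃ f ∈ B, ‖x‖ ≤ c * f x + ε := by
  obtain ⟨k, hk, hkv⟩ := carrierCode_mem_sets hL hD
  obtain ⟨T, hT, hTv⟩ := fracSet_mem_sets hL hD
  obtain ⟨d, hd, hdv⟩ := hD
  have hfr : ∀ r : ℝ, ∃ t, r < fracVal t := fun r =>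
    (exists_fracVal_between (lt_add_one r)).imp fun _ h => h.1
  -- Without the norm as a parameter, B is described by two properties of the dual unit ball: it is
  -- bounded above at each point, and a set of points on which it is uniformly bounded above is
  -- weakly bounded above.
  obtain ⟨B, hB, hBd, hpt, hS⟩ := M.exists_mem_sets
    (P := fun B => B ⊆ (d : ZFSet) ∧
      (∀ x ∈ (k : ZFSet), ∃ t ∈ (T : ZFSet), ∀ f ∈ B, ¬ ValMem t f x) ∧
      ∀ S ∈ hSet θ, S ⊆ (k : ZFSet) → (∃ t ∈ (T : ZFSet), ∀ x ∈ S, ∀ f ∈ B, ¬ ValMem t f x) →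
        ∀ f ∈ (d : ZFSet), ∃ t ∈ (T : ZFSet), ∀ x ∈ S, ¬ ValMem t f x)
    (by
      refine DefM.and ?_ (DefM.and ?_ ?_) <;>
      apply_rules [DefM.subset, DefM.ball, DefM.bex, DefM.allH, DefM.not, DefM.imp,
          DefM.valMem, IsTerm.const, IsTerm.var])
    (hL.fam {f | ‖f‖ ≤ 1}) (by
      rw [hdv, hkv, hTv]
      refine ⟨fun z hz => ?_, ?_, ?_⟩
      · obtain ⟨f, -, rfl⟩ := mem_famCode.1 hz
        exact coe_mem_famCode.2 (Set.mem_univ f)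
      · rw [← subCode_univ, forall_mem_subCode]
        intro x _
        obtain ⟨t, ht⟩ := hfr ‖x‖
        refine ⟨fracCode t, fracCode_mem_fracSet t, forall_mem_famCode.2 fun f hf => ?_⟩
        rw [valMem_fracCode, not_lt]
        refine ((le_abs_self _).trans (f.le_of_opNorm_le hf x)).trans ?_
        rw [one_mul]
        exact ht.le
      · rintro S - hSk ⟨t, ht, h⟩
        obtain ⟨S, rfl⟩ : ∃ S', S = subCode ι S' := ⟨_, eq_subCode hSk⟩
        obtain ⟨t, rfl⟩ := ZFSet.mem_range.1 ht
        refine forall_mem_famCode.2 fun f _ => ?_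
        obtain ⟨s, hs⟩ := hfr (‖f‖ * |fracVal t|)
        refine ⟨fracCode s, fracCode_mem_fracSet s, forall_mem_subCode.2 fun x hx => ?_⟩
        obtain ⟨g, hg1, hg⟩ := exists_dual_vector'' ℝ x
        have h1 := forall_mem_famCode.1 (forall_mem_subCode.1 h x hx) g hg1
        rw [valMem_fracCode, not_lt, hg] at h1
        rw [valMem_fracCode, not_lt]
        calc f x ≤ ‖f‖ * ‖x‖ := (le_abs_self _).trans (f.le_opNorm x)
          _ ≤ ‖f‖ * |fracVal t| := by
            gcongr
            exact h1.trans (le_abs_self _)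
          _ ≤ _ := hs.le)
  rw [hdv] at hBd
  obtain ⟨B, rfl⟩ : ∃ B', B = famCode ι B' := ⟨_, eq_famCode hBd⟩
  rw [hkv, hTv, ← subCode_univ, forall_mem_subCode] at hpt
  have hpt' : ∀ x : X, ∃ C : ℝ, ∀ f ∈ B, f x ≤ C := fun x => by
    obtain ⟨t, ht, h⟩ := hpt x (Set.mem_univ x)
    obtain ⟨t, rfl⟩ := ZFSet.mem_range.1 ht
    refine ⟨fracVal t, fun f hf => ?_⟩
    have := forall_mem_famCode.1 h f hf
    rwa [valMem_fracCode, not_lt] at this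
  obtain ⟨b, hb⟩ := banach_steinhaus (g := fun f : B => f.1) fun x => by
    obtain ⟨C, hC⟩ := hpt' x
    obtain ⟨C', hC'⟩ := hpt' (-x)
    refine ⟨max C C', fun f => abs_le'.2 ⟨(hC f f.2).trans (le_max_left _ _), ?_⟩⟩
    rw [← map_neg]
    exact (hC' f f.2).trans (le_max_right _ _)
  -- The one-sided polar of B is weakly bounded, hence norm bounded by Banach–Steinhaus in the
  -- bidual; this is what makes B norming.
  let S : Set X := {x | ∀ f ∈ B, f x ≤ 1}
  have hSw : ∀ f : StrongDual ℝ X, ∃ C : ℝ, ∀ x ∈ S, f x ≤ C := fun f => by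
    obtain ⟨s, hs⟩ := hfr 1
    obtain ⟨t, ht, h⟩ := hS (subCode ι S) (hL.sub S)
      (by rw [hkv, ← subCode_univ]; exact subCode_subset.2 (Set.subset_univ S))
      ⟨fracCode s, hTv ▸ fracCode_mem_fracSet s, forall_mem_subCode.2 fun x hx =>
        forall_mem_famCode.2 fun f hf => by
          rw [valMem_fracCode, not_lt]
          exact (hx f hf).trans hs.le⟩ (funCode ι f) (hdv ▸ coe_mem_famCode.2 (Set.mem_univ f))
    rw [hTv] at ht
    obtain ⟨t, rfl⟩ := ZFSet.mem_range.1 ht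
    refine ⟨fracVal t, fun x hx => ?_⟩
    have := forall_mem_subCode.1 h x hx
    rwa [valMem_fracCode, not_lt] at this
  obtain ⟨C₀, hC₀⟩ := banach_steinhaus
    (g := fun x : S => NormedSpace.inclusionInDoubleDual ℝ X x.1) fun f => by
    obtain ⟨C, hC⟩ := hSw f
    obtain ⟨C', hC'⟩ := hSw (-f)
    refine ⟨max C C', fun x => abs_le'.2 ⟨(hC x x.2).trans (le_max_left _ _), ?_⟩⟩
    exact (hC' x x.2).trans (le_max_right _ _)
  obtain ⟨C, hCpos, hC⟩ : ∃ C : ℝ, 0 < C ∧ ∀ x ∈ S, ‖x‖ ≤ C := by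
    refine ⟨max C₀ 1, by positivity, fun x hx => le_trans ?_ (le_max_left _ _)⟩
    have := hC₀ ⟨x, hx⟩
    rwa [← (NormedSpace.inclusionInDoubleDualLi (E := X) ℝ).norm_map x]
  have hBne : B.Nonempty := by
    by_contra hne
    rw [Set.not_nonempty_iff_eq_empty] at hne
    obtain ⟨x, hx⟩ := NormedSpace.exists_lt_norm ℝ X C
    exact hx.not_ge (hC x fun f hf => by simp [hne] at hf)
  refine ⟨B, b, C, hB, fun f hf => hb ⟨f, hf⟩, hCpos.le, fun x ε hε => ?_⟩
  by_contra! hlt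
  obtain ⟨f₀, hf₀⟩ := hBne
  have hx0 : 0 < ‖x‖ := by
    by_contra h0
    have hx0 : x = 0 := norm_le_zero_iff.1 (not_lt.1 h0)
    have := hlt f₀ hf₀
    rw [hx0, map_zero, norm_zero] at this
    linarith
  -- Dividing x by the first term puts it into S; the second keeps the divisor m positive when ‖x‖ ≤
  -- ε. Both are below ‖x‖ / C, while x / m ∈ S forces ‖x‖ ≤ m * C.
  have hlow : 0 < max ((‖x‖ - ε) / C) (‖x‖ / (2 * C)) := lt_max_of_lt_right (by positivity)
  set m := max ((‖x‖ - ε) / C) (‖x‖ / (2 * C))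
  have hxS : m⁻¹ • x ∈ S := fun f hf => by
    rw [map_smul, smul_eq_mul, inv_mul_le_iff₀ hlow, mul_one]
    refine le_trans ?_ (le_max_left _ _)
    rw [le_div_iff₀ hCpos]
    linarith [hlt f hf]
  have h1 := hC _ hxS
  rw [norm_smul, norm_inv, Real.norm_of_nonneg hlow.le, inv_mul_le_iff₀ hlow] at h1
  have h2 : m * C < ‖x‖ := by
    rw [← lt_div_iff₀ hCpos]
    refine max_lt ?_ ?_
    · gcongr; linarith
    · gcongr; linarith
  linarith

theorem isNorming_univ : IsNorming (Set.univ : Set (StrongDual ℝ X)) := by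
  refine ⟨1, fun x => ?_⟩
  rw [one_mul]
  by_cases hx : x = 0
  · rw [hx, norm_zero]
    exact Real.iSup_nonneg fun φ => by positivity
  · obtain ⟨f, hf, hfx⟩ := exists_dual_vector ℝ x (norm_ne_zero_iff.2 hx)
    have hf0 : f ≠ 0 := by
      rintro rfl
      simp at hf
    have hbdd : BddAbove (Set.range fun φ : {φ : StrongDual ℝ X // φ ∈ Set.univ ∧ φ ≠ 0} =>
        |φ.1 x| / ‖φ.1‖) := by
      refine ⟨‖x‖, ?_⟩
      rintro _ ⟨φ, rfl⟩
      exact div_le_of_le_mul₀ (norm_nonneg _) (norm_nonneg _)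
        ((φ.1.le_opNorm x).trans_eq (mul_comm _ _))
    refine le_trans ?_ (le_ciSup hbdd ⟨f, Set.mem_univ f, hf0⟩)
    simp [hf, hfx]

variable (ι) in
theorem generatesProjections_univ [CompleteSpace X] [Nontrivial X] (hX : IsWCG X) :
    GeneratesProjections ι (Set.univ : Set (StrongDual ℝ X)) := by
  obtain ⟨θ₀, hθ₀⟩ := exists_largeFor ι
  refine ⟨isNorming_univ, θ₀, fun θ hθ _ M _ hD => ?_⟩
  obtain ⟨B, b, c, hB, hb, hc, hn⟩ := exists_norming_mem_sets (hθ₀ θ hθ) hD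
  exact exists_isCompl_inducedSubspace (hθ₀ θ hθ) hD hX hB hb hc hn

end Decomposition

/-! ### The dual space is definable from the normed space. -/

section Normed

variable {X : Type u} [NormedAddCommGroup X] {ι : X ↪ ZFSet.{u}}

theorem pair_mem_normCode {x : X} {z : ZFSet.{u}} :
    ZFSet.pair (ι x) z ∈ normCode ι ↔ z = realCode ‖x‖ := by
  simp only [normCode, ZFSet.mem_range, ZFSet.pair_inj, ι.injective.eq_iff]
  exact ⟨fun ⟨y, h, e⟩ => h ▸ e.symm, fun h => ⟨x, rfl, h.symm⟩⟩

theorem pair_mem_addCode {x y z : X} :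
    ZFSet.pair (ZFSet.pair (ι x) (ι y)) (ι z) ∈ addCode ι ↔ x + y = z := by
  simp only [addCode, ZFSet.mem_range, ZFSet.pair_inj, ι.injective.eq_iff, Prod.exists]
  exact ⟨fun ⟨a, b, ⟨h1, h2⟩, h⟩ => h1 ▸ h2 ▸ h, fun h => ⟨x, y, ⟨rfl, rfl⟩, h⟩⟩

theorem valMem_normCode {x : X} {t : ZFSet.{u}} :
    ValMem t (normCode ι) (ι x) ↔ t ∈ realCode ‖x‖ := by
  simp [ValMem, pair_mem_normCode]

/-- If (n + 1) y is in the ball, then φ y ≤ τ / (n + 1); the same for -y gives continuity at 0. -/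
theorem continuous_of_additive_of_le {φ : X →+ ℝ} {ρ τ : ℝ} (hρ : 0 < ρ)
    (h : ∀ y, ‖y‖ ≤ ρ → φ y ≤ τ) : Continuous φ := by
  refine continuous_of_continuousAt_zero φ (Metric.continuousAt_iff.2 fun ε hε => ?_)
  obtain ⟨n, hn⟩ := exists_nat_gt (τ / ε)
  have hn' : τ < (n + 1 : ℝ) * ε := by
    rw [div_lt_iff₀ hε] at hn
    nlinarith
  refine ⟨ρ / (n + 1), by positivity, fun {y} hy => ?_⟩
  have key : ∀ y, ‖y‖ < ρ / (n + 1) → φ y < ε := by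
    intro y hy
    have h1 : ‖(n + 1) • y‖ ≤ ρ := by
      refine (norm_nsmul_le).trans ?_
      rw [lt_div_iff₀ (by positivity)] at hy
      push_cast
      linarith
    have h2 := h _ h1
    rw [map_nsmul, nsmul_eq_mul] at h2
    push_cast at h2
    have h3 : (n + 1 : ℝ) * φ y < (n + 1) * ε := h2.trans_lt hn'
    exact lt_of_mul_lt_mul_left h3 (by positivity)
  rw [dist_zero_right] at hy
  rw [map_zero, dist_zero_right, Real.norm_eq_abs, abs_lt]
  have := key (-y) (by rwa [norm_neg])
  rw [map_neg] at this
  exact ⟨by linarith, key y hy⟩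

end Normed

section DualDefinable

variable {X : Type u} [NormedAddCommGroup X] [NormedSpace ℝ X] {ι : X ↪ ZFSet.{u}}
  {θ : Cardinal.{u}} {M : ElemSub θ}

theorem pair_mem_smulCode {r : ZFSet.{u}} {x y : X} :
    ZFSet.pair (ZFSet.pair r (ι x)) (ι y) ∈ smulCode ι ↔ ∃ a : ℝ, realCode a = r ∧ a • x = y := by
  simp only [smulCode, ZFSet.mem_range, ZFSet.pair_inj, ι.injective.eq_iff, Prod.exists]
  exact ⟨fun ⟨a, b, ⟨h1, h2⟩, h⟩ => ⟨a, h1, h2 ▸ h⟩, fun ⟨a, h1, h2⟩ => ⟨a, x, ⟨h1, rfl⟩, h2⟩⟩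

theorem pair_realCode_mem_smulCode {a : ℝ} {x y : X} :
    ZFSet.pair (ZFSet.pair (realCode a) (ι x)) (ι y) ∈ smulCode ι ↔ a • x = y := by
  simp [pair_mem_smulCode, realCode_injective.eq_iff]

theorem LargeFor.real [Nontrivial X] (hL : LargeFor ι θ) (r : ℝ) : realCode r ∈ hSet θ := by
  obtain ⟨f, x, rfl⟩ := exists_dual_apply_eq (X := X) r
  exact (hSet_of_pair (hSet_transitive (hL.functional f) (pair_mem_funCode (x := x).2 rfl))).2

/-- `f` is a function from `c` to the scalars of the scalar multiplication `s`. -/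
def IsScalarFunction (θ : Cardinal.{u}) (c s f : ZFSet.{u}) : Prop :=
  (∀ p ∈ f, ∃ x ∈ c, ∃ r ∈ hSet θ, p = ZFSet.pair x r ∧
    ∃ y ∈ c, ∃ z ∈ c, ZFSet.pair (ZFSet.pair r y) z ∈ s) ∧
  (∀ x ∈ c, ∃ r ∈ hSet θ, ZFSet.pair x r ∈ f) ∧
  ∀ x ∈ c, ∀ r ∈ hSet θ, ∀ r' ∈ hSet θ, ZFSet.pair x r ∈ f → ZFSet.pair x r' ∈ f → r = r'

/-- `q = r + r'` for scalars, expressed through the addition `a` and scalar multiplication `s`. -/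
def IsScalarSum (c a s r r' q : ZFSet.{u}) : Prop :=
  ∀ w ∈ c, ∀ u ∈ c, ∀ v ∈ c, ∀ z ∈ c, ZFSet.pair (ZFSet.pair r w) u ∈ s →
    ZFSet.pair (ZFSet.pair r' w) v ∈ s → ZFSet.pair (ZFSet.pair q w) z ∈ s →
    ZFSet.pair (ZFSet.pair u v) z ∈ a

/-- `f` is additive. -/
def IsAdditiveCode (θ : Cardinal.{u}) (c a s f : ZFSet.{u}) : Prop :=
  ∀ x ∈ c, ∀ y ∈ c, ∀ z ∈ c, ZFSet.pair (ZFSet.pair x y) z ∈ a →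
    ∀ r ∈ hSet θ, ∀ r' ∈ hSet θ, ∀ q ∈ hSet θ, ZFSet.pair x r ∈ f → ZFSet.pair y r' ∈ f →
      ZFSet.pair z q ∈ f → IsScalarSum c a s r r' q

/-- The norm `n` satisfies `‖y‖ ≤ ‖z‖`. -/
def IsNormLE (θ : Cardinal.{u}) (n y z : ZFSet.{u}) : Prop :=
  ∀ r ∈ hSet θ, ∀ r' ∈ hSet θ, ZFSet.pair y r ∈ n → ZFSet.pair z r' ∈ n → r ⊆ r'

/-- `f` is bounded above on a ball. -/
def IsBoundedCode (θ : Cardinal.{u}) (c n f : ZFSet.{u}) : Prop :=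
  ∃ z ∈ c, (∃ w ∈ c, ¬ IsNormLE θ n z w) ∧ ∃ t ∈ hSet θ, (∃ x ∈ c, ValMem t n x) ∧
    ∀ y ∈ c, IsNormLE θ n y z → ¬ ValMem t f y

theorem DefM.isScalarFunction {c s : hSet θ} (hc : c ∈ M) (hs : s ∈ M) :
    DefM M fun v : Option Unit → hSet θ => IsScalarFunction θ c s (v none) := by
  unfold IsScalarFunction
  refine DefM.and ?_ (DefM.and ?_ ?_) <;>
  apply_rules [DefM.ball, DefM.bex, DefM.allH, DefM.exH, DefM.and, DefM.imp, DefM.eqPair,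
    DefM.eqVal, DefM.pairMem, DefM.pairPairMem, IsTerm.const, IsTerm.var]

theorem DefM.isScalarSum {c a s : hSet θ} (hc : c ∈ M) (ha : a ∈ M) (hs : s ∈ M) {α : Type}
    (i j k : α) : DefM M fun v : α → hSet θ => IsScalarSum c a s (v i) (v j) (v k) := by
  unfold IsScalarSum
  apply_rules [DefM.ball, DefM.imp, DefM.pairPairMem, IsTerm.const, IsTerm.var]

theorem DefM.isAdditiveCode {c a s : hSet θ} (hc : c ∈ M) (ha : a ∈ M) (hs : s ∈ M) :
    DefM M fun v : Option Unit → hSet θ => IsAdditiveCode θ c a s (v none) := by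
  unfold IsAdditiveCode
  apply_rules [DefM.isScalarSum, DefM.ball, DefM.allH, DefM.imp, DefM.pairMem, DefM.pairPairMem,
    IsTerm.const, IsTerm.var]

theorem DefM.isNormLE {n : hSet θ} (hn : n ∈ M) {α : Type} (i j : α) :
    DefM M fun v : α → hSet θ => IsNormLE θ n (v i) (v j) := by
  unfold IsNormLE
  apply_rules [DefM.allH, DefM.imp, DefM.pairMem, DefM.subset, IsTerm.const, IsTerm.var]

theorem DefM.isBoundedCode {c n : hSet θ} (hc : c ∈ M) (hn : n ∈ M) :
    DefM M fun v : Option Unit → hSet θ => IsBoundedCode θ c n (v none) := by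
  unfold IsBoundedCode
  apply_rules [DefM.ball, DefM.bex, DefM.exH, DefM.and, DefM.not, DefM.imp, DefM.isNormLE,
    DefM.valMem, IsTerm.const, IsTerm.var]

theorem isNormLE_normCode [Nontrivial X] (hL : LargeFor ι θ) {y z : X} :
    IsNormLE θ (normCode ι) (ι y) (ι z) ↔ ‖y‖ ≤ ‖z‖ := by
  constructor
  · intro h
    exact realCode_subset.1 (h _ (hL.real _) _ (hL.real _) (pair_mem_normCode.2 rfl)
      (pair_mem_normCode.2 rfl))
  · rintro h r - r' - h1 h2
    rw [pair_mem_normCode.1 h1, pair_mem_normCode.1 h2]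
    exact realCode_subset.2 h

/-- One nonzero vector w with (r + r') • w = q • w determines the sum, so addition of reals is read
off from X. -/
theorem isScalarSum_iff [Nontrivial X] {r r' q : ℝ} :
    IsScalarSum (carrierCode ι) (addCode ι) (smulCode ι) (realCode r) (realCode r') (realCode q) ↔
      r + r' = q := by
  simp only [IsScalarSum, forall_mem_carrierCode, pair_realCode_mem_smulCode, pair_mem_addCode]
  constructor
  · intro h
    obtain ⟨w, hw⟩ := exists_ne (0 : X)
    have := h w _ _ _ rfl rfl rfl
    rw [← add_smul] at this
    exact smul_left_injective ℝ hw this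
  · rintro rfl w u v z rfl rfl rfl
    exact (add_smul _ _ _).symm

/-- The dual space is definable from the norm and the linear structure. -/
theorem mem_famCode_univ_iff [Nontrivial X] (hL : LargeFor ι θ) {f : ZFSet.{u}} (hf : f ∈ hSet θ) :
    f ∈ famCode ι Set.univ ↔ IsScalarFunction θ (carrierCode ι) (smulCode ι) f ∧
      IsAdditiveCode θ (carrierCode ι) (addCode ι) (smulCode ι) f ∧
      IsBoundedCode θ (carrierCode ι) (normCode ι) f := by
  constructor
  · intro h
    obtain ⟨g, -, rfl⟩ := mem_famCode.1 h
    refine ⟨⟨fun p hp => ?_, ?_, ?_⟩, ?_, ?_⟩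
    · obtain ⟨x, rfl⟩ := ZFSet.mem_range.1 hp
      exact ⟨ι x, coe_mem_carrierCode x, realCode (g x), hL.real _, rfl, ι x, coe_mem_carrierCode x,
        ι (g x • x), coe_mem_carrierCode _, pair_realCode_mem_smulCode.2 rfl⟩
    · exact forall_mem_carrierCode.2 fun x => ⟨_, hL.real (g x), pair_mem_funCode.2 rfl⟩
    · refine forall_mem_carrierCode.2 fun x r _ r' _ h1 h2 => ?_
      rw [pair_mem_funCode.1 h1, pair_mem_funCode.1 h2]
    · refine forall_mem_carrierCode.2 fun x => forall_mem_carrierCode.2 fun y =>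
        forall_mem_carrierCode.2 fun z hz r _ r' _ q _ h1 h2 h3 => ?_
      rw [pair_mem_funCode.1 h1, pair_mem_funCode.1 h2, pair_mem_funCode.1 h3, isScalarSum_iff,
        ← pair_mem_addCode.1 hz, map_add]
    · obtain ⟨z, hz⟩ := exists_ne (0 : X)
      -- The bound t has to be recognisable as a fraction, which is coded by its lying below some
      -- norm; hence the long vector x.
      obtain ⟨t, ht, -⟩ := exists_fracVal_between (lt_add_one (‖g‖ * ‖z‖))
      obtain ⟨x, hx⟩ := NormedSpace.exists_lt_norm ℝ X (fracVal t)
      refine ⟨ι z, coe_mem_carrierCode z, ⟨ι 0, coe_mem_carrierCode 0, ?_⟩, fracCode t,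
        hSet_transitive hL.frac (fracCode_mem_fracSet t), ⟨ι x, coe_mem_carrierCode x,
          valMem_normCode.2 (fracCode_mem_realCode.2 hx)⟩, forall_mem_carrierCode.2 fun y hy => ?_⟩
      · rw [isNormLE_normCode hL, norm_zero, norm_le_zero_iff]
        exact hz
      · rw [isNormLE_normCode hL] at hy
        rw [valMem_fracCode, not_lt]
        calc g y ≤ ‖g‖ * ‖y‖ := (le_abs_self _).trans (g.le_opNorm y)
          _ ≤ ‖g‖ * ‖z‖ := by gcongr
          _ ≤ _ := ht.le
  · rintro ⟨⟨h1, h2, h3⟩, hadd, hbd⟩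
    have hp : ∀ p ∈ f, ∃ (x : X) (r : ℝ), p = ZFSet.pair (ι x) (realCode r) := by
      intro p hp
      obtain ⟨_, hx, r, -, h, _, hy, _, hz, hs⟩ := h1 p hp
      obtain ⟨x, rfl⟩ := mem_carrierCode.1 hx
      obtain ⟨y, rfl⟩ := mem_carrierCode.1 hy
      obtain ⟨z, rfl⟩ := mem_carrierCode.1 hz
      obtain ⟨a, rfl, -⟩ := pair_mem_smulCode.1 hs
      exact ⟨x, a, h⟩
    have hex : ∀ x : X, ∃ r : ℝ, ZFSet.pair (ι x) (realCode r) ∈ f := by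
      intro x
      obtain ⟨r, -, hr⟩ := h2 (ι x) (coe_mem_carrierCode x)
      obtain ⟨y, a, h⟩ := hp _ hr
      obtain ⟨-, rfl⟩ := ZFSet.pair_inj.1 h
      exact ⟨a, hr⟩
    choose φ hφ using hex
    have huniq : ∀ x r, ZFSet.pair (ι x) (realCode r) ∈ f → r = φ x := fun x r hr =>
      realCode_injective (h3 _ (coe_mem_carrierCode x) _ (hL.real _) _ (hL.real _) hr (hφ x))
    have hφadd : ∀ x y, φ (x + y) = φ x + φ y := fun x y =>
      (isScalarSum_iff.1 (hadd (ι x) (coe_mem_carrierCode x) (ι y) (coe_mem_carrierCode y)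
        (ι (x + y)) (coe_mem_carrierCode _) (pair_mem_addCode.2 rfl) _ (hL.real _) _ (hL.real _) _
        (hL.real _) (hφ x) (hφ y) (hφ (x + y)))).symm
    obtain ⟨_, hz, ⟨_, hw, hzw⟩, t, -, ⟨_, hx, ht⟩, hbd⟩ := hbd
    obtain ⟨z, rfl⟩ := mem_carrierCode.1 hz
    obtain ⟨w, rfl⟩ := mem_carrierCode.1 hw
    obtain ⟨x, rfl⟩ := mem_carrierCode.1 hx
    obtain ⟨t, -, rfl⟩ := mem_realCode.1 (valMem_normCode.1 ht)
    rw [isNormLE_normCode hL, not_le] at hzw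
    let ψ : X →+ ℝ := AddMonoidHom.mk' φ hφadd
    have hψ : Continuous ψ := continuous_of_additive_of_le ((norm_nonneg w).trans_lt hzw)
      (τ := fracVal t) fun y hy => by
        have := hbd (ι y) (coe_mem_carrierCode y) ((isNormLE_normCode hL).2 hy)
        by_contra! hlt
        exact this ⟨realCode (φ y), hφ y, fracCode_mem_realCode.2 hlt⟩
    -- A continuous additive map is real-linear, so homogeneity was not part of the code.
    refine mem_famCode.2 ⟨ψ.toRealLinearMap hψ, Set.mem_univ _, ?_⟩
    ext p
    constructor
    · intro hpf
      obtain ⟨x, rfl⟩ := ZFSet.mem_range.1 hpf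
      exact hφ x
    · intro hpf
      obtain ⟨x, r, rfl⟩ := hp p hpf
      rw [huniq x r hpf]
      exact pair_mem_funCode.2 rfl

variable (ι) in
-- With X ∈ M the true dual unit ball lies in M, so b = c = 1 and the projection has norm exactly 1.
theorem exists_projection_of_submodel [CompleteSpace X] [Nontrivial X] (hX : IsWCG X) :
    ∃ θ₀ : Cardinal.{u}, ∀ θ : Cardinal.{u}, θ₀ < θ → θ.IsRegular →
      ∀ M : ElemSub θ, spaceCode ι ∈ M.sets →
        ∃ P : X →L[ℝ] X, P ∘L P = P ∧ ‖P‖ = 1 ∧ Set.range P = inducedSubspace ι M ∧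
          P.ker = leftAnnihilator (famInter ι Set.univ M) := by
  obtain ⟨θ₀, hθ₀⟩ := exists_largeFor ι
  refine ⟨θ₀, fun θ hθ _ M hM => ?_⟩
  have hL := hθ₀ θ hθ
  obtain ⟨hc, h⟩ := M.of_pair_mem_sets hM
  obtain ⟨ha, h⟩ := M.of_pair_mem_sets h
  obtain ⟨hs, hn⟩ := M.of_pair_mem_sets h
  obtain ⟨c, hc, hcv⟩ := hc
  obtain ⟨a, ha, hav⟩ := ha
  obtain ⟨s, hs, hsv⟩ := hs
  obtain ⟨n, hn, hnv⟩ := hn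
  have hD : famCode ι Set.univ ∈ M.sets := by
    refine M.mem_sets_of_def (Q := fun f => IsScalarFunction θ c s f ∧
      IsAdditiveCode θ c a s f ∧ IsBoundedCode θ c n f) hL.dual ((DefM.isScalarFunction hc hs).and
      ((DefM.isAdditiveCode hc ha hs).and (DefM.isBoundedCode hc hn))) fun f hf => ?_
    rw [hcv, hav, hsv, hnv]
    exact mem_famCode_univ_iff hL hf
  have hB : famCode ι {f : StrongDual ℝ X | ‖f‖ ≤ 1} ∈ M.sets := by
    obtain ⟨d, hd, hdv⟩ := hD
    refine M.mem_sets_of_def (Q := fun f => f ∈ (d : ZFSet) ∧ ∀ x ∈ (c : ZFSet), ∀ r ∈ hSet θ,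
      ∀ r' ∈ hSet θ, ZFSet.pair x r ∈ f → ZFSet.pair x r' ∈ (n : ZFSet) → r ⊆ r') (hL.fam _)
      (by apply_rules [DefM.subset, DefM.ball, DefM.allH, DefM.and, DefM.imp, DefM.mem,
        DefM.pairMem, IsTerm.const, IsTerm.var]) fun f _ => ?_
    rw [hdv, hcv, hnv, mem_famCode]
    constructor
    · rintro ⟨f, hf, rfl⟩
      refine ⟨coe_mem_famCode.2 (Set.mem_univ f), forall_mem_carrierCode.2 fun x r _ r' _ h h' => ?_⟩
      rw [pair_mem_funCode.1 h, pair_mem_normCode.1 h', realCode_subset]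
      simpa using (le_abs_self _).trans (f.le_of_opNorm_le hf x)
    · rintro ⟨hfd, h⟩
      obtain ⟨f, -, rfl⟩ := mem_famCode.1 hfd
      have h' : ∀ x, f x ≤ ‖x‖ := fun x => realCode_subset.1 (h _ (coe_mem_carrierCode x) _
        (hL.real _) _ (hL.real _) (pair_mem_funCode.2 rfl) (pair_mem_normCode.2 rfl))
      refine ⟨f, f.opNorm_le_bound zero_le_one fun x => ?_, rfl⟩
      rw [one_mul, Real.norm_eq_abs, abs_le']
      exact ⟨h' x, by simpa using h' (-x)⟩
  have hnorm : ∀ x : X, ∀ ε > 0, ∃ f ∈ {f : StrongDual ℝ X | ‖f‖ ≤ 1}, ‖x‖ ≤ 1 * f x + ε := by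
    intro x ε hε
    obtain ⟨f, hf, hfx⟩ := exists_dual_vector'' ℝ x
    refine ⟨f, hf, ?_⟩
    rw [hfx, RCLike.ofReal_real_eq_id, id]
    linarith
  obtain ⟨Y, hY, hYc⟩ := exists_isCompl_inducedSubspace hL hD hX hB (fun f hf => hf) zero_le_one
    hnorm
  refine exists_projection hY hYc (exists_ne_zero_mem_sets hL hD) fun x hx ε hε => ?_
  simpa only [one_mul] using
    norming_on_submodel hL hB (fun f hf => hf) zero_le_one hnorm x hx ε hε

end DualDefinable

/-! ### Density and the projectional resolution of the identity. -/

section Density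

variable {X : Type u} [TopologicalSpace X]

theorem exists_dense_card_eq_dens : ∃ T : Set X, Dense T ∧ #T = dens (Set.univ : Set X) := by
  have hne : {c | ∃ T : Set X, T ⊆ Set.univ ∧ Set.univ ⊆ closure T ∧ #T = c}.Nonempty :=
    ⟨_, Set.univ, subset_rfl, subset_closure, rfl⟩
  obtain ⟨T, -, h, hT⟩ := csInf_mem hne
  exact ⟨T, fun x => h (Set.mem_univ x), hT⟩

theorem dens_closure_le (A : Set X) : dens (closure A) ≤ #A :=
  csInf_le' ⟨A, subset_closure, subset_rfl, rfl⟩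

end Density

section Resolution

/-- The language whose function symbols of each arity are the elements of `C`. -/
def operationLang (C : Type) : FirstOrder.Language := ⟨fun _ => C, fun _ => Empty⟩

/-- Take generated substructures, each c acting as a symbol of every arity. Countably many symbols
bound the cardinality; finite arities give continuity along directed unions. -/
theorem exists_closure_operator {Z : Type u} {C : Type} [Countable C] (op : C → List Z → Z) :
    ∃ cl : Set Z → Set Z, (∀ S, S ⊆ cl S) ∧ Monotone cl ∧
      (∀ S c l, (∀ z ∈ l, z ∈ cl S) → op c l ∈ cl S) ∧ (∀ S : Set Z, #(cl S) ≤ max ℵ₀ #S) ∧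
      ∀ {β : Type (u + 1)} [Nonempty β] (S : β → Set Z), Directed (· ⊆ ·) S →
        cl (⋃ i, S i) = ⋃ i, cl (S i) := by
  let _ : (operationLang C).Structure Z :=
    { funMap := fun {n} (c : C) v => op c (List.ofFn v), RelMap := fun r => r.elim }
  refine ⟨fun S => FirstOrder.Language.Substructure.closure (operationLang C) S,
    fun S => FirstOrder.Language.Substructure.subset_closure,
    fun S T h => FirstOrder.Language.Substructure.closure_mono h, ?_, ?_, ?_⟩
  · intro S c l hl
    have := (FirstOrder.Language.Substructure.closure (operationLang C) S).fun_mem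
      (n := l.length) (show (operationLang C).Functions l.length from c) l.get
      fun i => hl _ (l.get_mem i)
    have h2 : op c (List.ofFn l.get) ∈
      FirstOrder.Language.Substructure.closure (operationLang C) S := this
    rwa [List.ofFn_get] at h2
  · intro S
    have h1 := FirstOrder.Language.Substructure.lift_card_closure_le (L := operationLang C) (s := S)
    have : Countable (Σ i, (operationLang C).Functions i) :=
      inferInstanceAs (Countable (Σ _ : ℕ, C))
    have h2 : #(Σ i, (operationLang C).Functions i) ≤ ℵ₀ := Cardinal.mk_le_aleph0
    rw [Cardinal.lift_uzero, Cardinal.lift_uzero] at h1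
    refine h1.trans (max_le (le_max_left _ _) ?_)
    refine (add_le_add (le_max_right ℵ₀ #S) ((Cardinal.lift_le.2 h2).trans ?_)).trans_eq
      (Cardinal.add_eq_self (le_max_left _ _))
    rw [Cardinal.lift_aleph0]
    exact le_max_left _ _
  · intro β _ S hS
    ext z
    rw [SetLike.mem_coe, FirstOrder.Language.Substructure.closure_iUnion,
      FirstOrder.Language.Substructure.mem_iSup_of_directed]
    · simp
    · exact fun i j => (hS i j).imp fun k h =>
        ⟨FirstOrder.Language.Substructure.closure_mono h.1,
          FirstOrder.Language.Substructure.closure_mono h.2⟩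

variable {X : Type u} [NormedAddCommGroup X] [NormedSpace ℝ X]

theorem aleph0_le_dens [Nontrivial X] : ℵ₀ ≤ dens (Set.univ : Set X) := by
  obtain ⟨T, hT, hc⟩ := exists_dense_card_eq_dens (X := X)
  rw [← hc]
  by_contra! h
  have hfin : T.Finite := Cardinal.lt_aleph0_iff_set_finite.1 h
  have huniv : T = Set.univ := by rw [← hT.closure_eq, hfin.isClosed.closure_eq]
  rw [huniv] at hfin
  have : NoncompactSpace X := NormedSpace.noncompactSpace ℝ X
  exact noncompact_univ X hfin.isCompact

/-- Increasing, continuous families of sets `A` of points and `F` of functionals of controlled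
cardinality which are closed under the operations that make `cl A` and `⊥F` complementary. -/
theorem exists_closing_off [Nontrivial X] (K : Set X) :
    ∃ (A : Set X → Set X) (F : Set X → Set (StrongDual ℝ X)),
      (∀ S, S ⊆ A S) ∧ Monotone A ∧ Monotone F ∧ (∀ S : Set X, #(A S) ≤ max ℵ₀ #S) ∧
      (∀ {β : Type (u + 1)} [Nonempty β] (S : β → Set X), Directed (· ⊆ ·) S →
        A (⋃ i, S i) = ⋃ i, A (S i)) ∧
      (∀ S, ∃ x ∈ A S, x ≠ 0) ∧ (∀ S, ∀ x ∈ A S, ∀ y ∈ A S, ∀ q : ℚ, x + (q : ℝ) • y ∈ A S) ∧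
      (∀ S, ∀ x ∈ A S, ∃ f ∈ F S, ‖f‖ ≤ 1 ∧ f x = ‖x‖) ∧
      ∀ S, ∀ p ∈ K, ∀ G : Finset (StrongDual ℝ X), ↑G ⊆ F S → ∀ ε > 0,
        ∃ q ∈ K, q ∈ A S ∧ ∀ g ∈ G, |g q - g p| < ε := by
  classical
  obtain ⟨x₀, hx₀⟩ := exists_ne (0 : X)
  have hdual : ∀ x : X, ∃ f : StrongDual ℝ X, ‖f‖ ≤ 1 ∧ f x = ‖x‖ := fun x => by
    obtain ⟨f, hf, hfx⟩ := exists_dual_vector'' ℝ x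
    exact ⟨f, hf, by simpa using hfx⟩
  choose φ hφ hφx using hdual
  let cond : List (ℚ × ℚ) → List (X ⊕ StrongDual ℝ X) → X → Prop := fun L l p =>
    p ∈ K ∧ ∀ e ∈ L.zip l, ∀ g, e.2 = Sum.inr g → (e.1.1 : ℝ) < g p ∧ g p < (e.1.2 : ℝ)
  -- A rational yields x + q • y from two points and a norming functional from one; a list of
  -- rational intervals picks a point of K where the given functionals take values in them. The
  -- default x₀ makes every hull contain a nonzero point.
  let op : ℚ ⊕ List (ℚ × ℚ) → List (X ⊕ StrongDual ℝ X) → X ⊕ StrongDual ℝ X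
    | .inl q, [.inl x, .inl y] => .inl (x + (q : ℝ) • y)
    | .inl _, [.inl x] => .inr (φ x)
    | .inl _, _ => .inl x₀
    | .inr L, l => .inl (if h : ∃ p, cond L l p then h.choose else x₀)
  obtain ⟨cl, hsub, hmono, hop, hcard, hunion⟩ := exists_closure_operator op
  refine ⟨fun S => {x | Sum.inl x ∈ cl (Sum.inl '' S)}, fun S => {f | Sum.inr f ∈ cl (Sum.inl '' S)},
    fun S x hx => hsub _ ⟨x, hx, rfl⟩, fun S T h x hx => hmono (Set.image_mono h) hx,
    fun S T h x hx => hmono (Set.image_mono h) hx, fun S => ?_, fun {β} _ S hS => ?_, fun S => ?_,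
    fun S x hx y hy q => ?_, fun S x hx => ⟨φ x, ?_, hφ x, hφx x⟩, fun S p hp G hG ε hε => ?_⟩
  · have himage : #(Sum.inl '' S : Set (X ⊕ StrongDual ℝ X)) ≤ #S := Cardinal.mk_image_le
    refine le_trans ?_ ((hcard _).trans (max_le_max le_rfl himage))
    exact Cardinal.mk_le_of_injective
      (f := fun x : {x | Sum.inl x ∈ cl (Sum.inl '' S)} =>
        (⟨Sum.inl x.1, x.2⟩ : cl (Sum.inl '' S)))
      fun x y h => Subtype.ext (Sum.inl_injective (congrArg Subtype.val h))
  · ext x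
    change Sum.inl x ∈ cl (Sum.inl '' ⋃ i, S i) ↔ _
    rw [Set.image_iUnion, hunion _ fun i j => (hS i j).imp fun k h =>
      ⟨Set.image_mono h.1, Set.image_mono h.2⟩]
    simp only [Set.mem_iUnion]
    rfl
  · exact ⟨x₀, hop _ (.inl 0) [] (by simp), hx₀⟩
  · exact hop _ (.inl q) [.inl x, .inl y] (by simpa using ⟨hx, hy⟩)
  · exact hop _ (.inl 0) [.inl x] (by simpa using hx)
  · have hlo : ∀ g : StrongDual ℝ X, ∃ r : ℚ, g p - ε < r ∧ (r : ℝ) < g p := fun g =>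
      exists_rat_btwn (by linarith)
    have hup : ∀ g : StrongDual ℝ X, ∃ r : ℚ, g p < r ∧ (r : ℝ) < g p + ε := fun g =>
      exists_rat_btwn (by linarith)
    choose lo hlo1 hlo2 using hlo
    choose up hup1 hup2 using hup
    let L := G.toList.map fun g => (lo g, up g)
    let l : List (X ⊕ StrongDual ℝ X) := G.toList.map Sum.inr
    have hcond : ∀ q, cond L l q ↔ q ∈ K ∧ ∀ g ∈ G, (lo g : ℝ) < g q ∧ g q < (up g : ℝ) := by
      intro q
      simp only [cond, L, l, List.zip_map']
      simp
    have hex : ∃ q, cond L l q := ⟨p, (hcond p).2 ⟨hp, fun g _ => ⟨hlo2 g, hup1 g⟩⟩⟩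
    have hmem := hop (Sum.inl '' S) (.inr L) l fun z hz => by
      obtain ⟨g, hg, rfl⟩ := List.mem_map.1 hz
      exact hG (Finset.mem_coe.2 (Finset.mem_toList.1 hg))
    have hval : op (.inr L) l = .inl hex.choose := by
      simp only [op, dif_pos hex]
    rw [hval] at hmem
    obtain ⟨hqK, hq⟩ := (hcond _).1 hex.choose_spec
    refine ⟨_, hqK, hmem, fun g hg => ?_⟩
    obtain ⟨h1, h2⟩ := hq g hg
    rw [abs_lt]
    exact ⟨by linarith [hlo1 g], by linarith [hup2 g]⟩

theorem exists_isPRI [CompleteSpace X] [Nontrivial X] (hX : IsWCG X) :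
    ∃ P : Ordinal.{u} → X →L[ℝ] X, IsPRI (dens (Set.univ : Set X)).ord P := by
  obtain ⟨K, hK, hKd⟩ := hX
  obtain ⟨A, F, hsub, hAmono, hFmono, hcard, hunion, hne, hadd, hnorm, happ⟩ :=
    exists_closing_off K
  obtain ⟨T, hT, hTc⟩ := exists_dense_card_eq_dens (X := X)
  rw [← Cardinal.mk_ord_toType (dens _)] at hTc
  obtain ⟨e⟩ := Cardinal.eq.1 hTc
  set l := (dens (Set.univ : Set X)).ord
  have hlim : Order.IsSuccLimit l := Cardinal.isSuccLimit_ord aleph0_le_dens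
  let idx : T → Ordinal.{u} := fun x => Ordinal.typein (α := l.ToType) (· < ·) (e x)
  have hidx : Function.Injective idx := (Ordinal.typein_injective _).comp e.injective
  have hidx_lt : ∀ x, idx x < l := fun x => Ordinal.typein_lt_self _
  -- The first ξ points of the enumerated dense set; strict inequality gives continuity at limits
  -- and cardinality at most that of ξ.
  let S : Ordinal.{u} → Set X := fun ξ => Subtype.val '' {x : T | idx x < ξ}
  have hSmono : Monotone S := fun ξ η h =>
    Set.image_mono fun x (hx : idx x < ξ) => hx.trans_le h
  have hScard : ∀ ξ, #(S ξ) ≤ ξ.card := by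
    intro ξ
    refine Cardinal.mk_image_le.trans (Cardinal.lift_le.{u + 1}.1 ?_)
    rw [← Cardinal.mk_Iio_ordinal, ← Cardinal.lift_id'.{u, u + 1} #(Set.Iio ξ)]
    exact Cardinal.lift_mk_le_lift_mk_of_injective (f := fun x : {x : T | idx x < ξ} =>
      (⟨idx x.1, x.2⟩ : Set.Iio ξ))
      fun x y h => Subtype.ext (hidx (congrArg Subtype.val h))
  have hSlim : ∀ δ, Order.IsSuccLimit δ → S δ = ⋃ ξ : Set.Iio δ, S ξ := by
    intro δ hδ
    refine subset_antisymm ?_ (Set.iUnion_subset fun ξ => hSmono (le_of_lt ξ.2))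
    rintro _ ⟨x, hx, rfl⟩
    exact Set.mem_iUnion.2 ⟨⟨Order.succ (idx x), Set.mem_Iio.2 (hδ.succ_lt hx)⟩, x,
      Order.lt_succ (idx x), rfl⟩
  have hAlim : ∀ δ, Order.IsSuccLimit δ → A (S δ) = ⋃ ξ ∈ Set.Iio δ, A (S ξ) := by
    intro δ hδ
    have : Nonempty (Set.Iio δ) := ⟨⟨⊥, hδ.bot_lt⟩⟩
    rw [hSlim δ hδ, hunion, Set.biUnion_eq_iUnion]
    exact Monotone.directed_le fun ξ η h => hSmono h
  have hn : ∀ ξ, ∀ x ∈ A (S ξ), ∀ ε > 0, ∃ f ∈ F (S ξ), ‖f‖ ≤ 1 ∧ ‖x‖ ≤ f x + ε := by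
    intro ξ x hx ε hε
    obtain ⟨f, hf, hf1, hfx⟩ := hnorm _ x hx
    exact ⟨f, hf, hf1, by linarith⟩
  have hproj : ∀ ξ, ∃ P : X →L[ℝ] X, P ∘L P = P ∧ ‖P‖ = 1 ∧ Set.range P = closure (A (S ξ)) ∧
      P.ker = leftAnnihilator (F (S ξ)) := by
    intro ξ
    obtain ⟨Y, hY⟩ := exists_submodule_eq_closure (A := A (S ξ)) ((hne _).imp fun _ h => h.1)
      fun x hx y hy c => by
        -- The hull is closed only under rational combinations; density of ℚ gives real ones in the
        -- closure.
        have := map_mem_closure (f := fun c : ℝ => x + c • y) (t := A (S ξ)) (by fun_prop)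
          (Rat.denseRange_cast c) (by rintro _ ⟨q, rfl⟩; exact hadd _ x hx y hy q)
        exact this
    exact exists_projection hY (isCompl_leftAnnihilator hK hKd hY zero_le_one zero_le_one
      (by simpa only [one_mul] using hn ξ) (happ _)) (hne _) (hn ξ)
  choose P hPP hP1 hPr hPk using hproj
  have hfix : ∀ ξ x, x ∈ closure (A (S ξ)) → P ξ x = x := by
    intro ξ x hx
    rw [← hPr] at hx
    obtain ⟨y, rfl⟩ := hx
    exact DFunLike.congr_fun (hPP ξ) y
  have hcl : ∀ δ, Order.IsSuccLimit δ →
      closure (A (S δ)) = closure (⋃ ξ ∈ Set.Iio δ, Set.range (P ξ)) := by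
    intro δ hδ
    rw [hAlim δ hδ]
    refine subset_antisymm (closure_mono (Set.iUnion₂_mono fun ξ _ => ?_))
      (closure_minimal (Set.iUnion₂_subset fun ξ hξ => ?_) isClosed_closure)
    · rw [hPr]; exact subset_closure
    · rw [hPr]
      exact closure_mono (Set.subset_biUnion_of_mem (u := fun ξ => A (S ξ)) hξ)
  refine ⟨P, ⟨⟨hlim, fun ξ _ => hPP ξ, fun ξ η h _ => ⟨?_, ?_⟩, fun δ _ hδ => ?_, ?_⟩,
    fun ξ _ => hP1 ξ, fun ξ _ => ?_⟩⟩
  · ext x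
    refine hfix η _ (closure_mono (hAmono (hSmono h.le)) ?_)
    rw [← hPr]
    exact ⟨x, rfl⟩
  · ext x
    -- Since F grows with the index, the kernels decrease: ker P_η ⊆ ker P_ξ.
    have hk : x - P η x ∈ (P ξ).ker := by
      have h1 : x - P η x ∈ (P η).ker := by
        have := DFunLike.congr_fun (hPP η) x
        rw [LinearMap.mem_ker, ContinuousLinearMap.coe_coe, map_sub, sub_eq_zero]
        exact this.symm
      rw [hPk] at h1 ⊢
      exact fun f hf => h1 f (hFmono (hSmono h.le) hf)
    rw [LinearMap.mem_ker, ContinuousLinearMap.coe_coe, map_sub, sub_eq_zero] at hk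
    exact hk.symm
  · rw [hPr, hcl δ hδ]
  -- Exhaustion is the limit formula at l itself, where S l is all of T.
  · rw [← hcl l hlim, Set.eq_univ_iff_forall]
    intro x
    have hTS : T ⊆ S l := fun y hy => ⟨⟨y, hy⟩, hidx_lt _, rfl⟩
    exact closure_mono (hTS.trans (hsub _)) (hT x)
  · rw [hPr]
    refine (dens_closure_le _).trans ((hcard _).trans (max_le ?_ ?_))
    · exact le_add_self
    · exact (hScard ξ).trans le_self_add

end Resolution

end WCGProj

theorem mainTheorem9 (X : Type u) [NormedAddCommGroup X] [NormedSpace ℝ X] [CompleteSpace X]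
    [Nontrivial X] (hX : WCGProj.IsWCG X) :
    (∀ ι : X ↪ ZFSet.{u},
      (∃ θ₀ : Cardinal.{u}, ∀ θ : Cardinal.{u}, θ₀ < θ → θ.IsRegular →
        ∀ M : WCGProj.ElemSub θ, WCGProj.spaceCode ι ∈ M.sets →
          ∃ P : X →L[ℝ] X, P ∘L P = P ∧ ‖P‖ = 1 ∧
            Set.range P = WCGProj.inducedSubspace ι M ∧
            P.ker = WCGProj.leftAnnihilator (WCGProj.famInter ι Set.univ M)) ∧
      WCGProj.GeneratesProjections ι (Set.univ : Set (StrongDual ℝ X))) ∧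
    ∃ P : Ordinal.{u} → X →L[ℝ] X, WCGProj.IsPRI (WCGProj.dens (Set.univ : Set X)).ord P :=
  ⟨fun ι => ⟨WCGProj.exists_projection_of_submodel ι hX, WCGProj.generatesProjections_univ ι hX⟩,
    WCGProj.exists_isPRI hX⟩
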